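/- **Setting.** Let $\Phi=[\phi_{\min},\phi_{\max}]$ with $\phi_{\min}<\phi_{\max}$. A probe state $\rho_{\eta_1}$ (a density operator on a Hilbert space) undergoes a dynamical process $\kappa_{\phi,\eta_2}$ (a map from states to states) and is then measured by a POVM $\Pi_{\eta_3}$ on $\mathbb R$ whose outcomes lie in a fixed bounded interval $[a,b]$. Here $\phi\in\Phi$ is the parameter of interest and $\boldsymbol\eta=(\eta_1,\eta_2,\eta_3)$ are noise parameters. A single outcome has the distribution $p(B\mid\phi,\boldsymbol\eta)=\operatorname{Tr}[\kappa_{\phi,\eta_2}(\rho_{\eta_1})\,\Pi_{\eta_3}(B)]$; let $f_{\boldsymbol\eta}(\phi)$ be its expectation. Let $E$ be a set of noise parameters such that for every $\boldsymbol\eta\in E$: $f_{\boldsymbol\eta}$ is injective and twice differentiable on $\Phi$ (one-sided at the end points), $f_{\boldsymbol\eta}'\neq0$ on $\Phi$, and $L_{\boldsymbol\eta}:=\max_{t\in\Phi}\left|f_{\boldsymbol\eta}'(t)^{-3}f_{\boldsymbol\eta}''(t)\right|$ is finite (maxima are read as suprema). For data $x^n=(x_1,\dots,x_n)$ put $S_n=\frac1n\sum_i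 x_i$, $V_n=\frac1{n-1}\sum_i(x_i-S_n)^2$, $V_{\max}=(b-a)^2/4$, and let $$\phi^{\mathrm{LS}}_n(x^n,\boldsymbol\eta)=\operatorname*{argmin}_{t\in\Phi}|S_n-f_{\boldsymbol\eta}(t)|$$ be the least squares estimate computed with $\boldsymbol\eta$. For $0<\epsilon<1$ put, with $f_{\boldsymbol\eta}'$ evaluated at $\phi^{\mathrm{LS}}_n(x^n,\boldsymbol\eta)$, $$\delta_1=\frac{1}{|f_{\boldsymbol\eta}'|}\sqrt{\tfrac2nV_{\max}\ln\tfrac2\epsilon}+\frac{L_{\boldsymbol\eta}}{n}V_{\max}\ln\tfrac2\epsilon,\qquad \delta_2=\frac{1}{|f_{\boldsymbol\eta}'|}\,r+\frac{L_{\boldsymbol\eta}}2\,r^2,\qquad r=\sqrt{\tfrac2nV_n\ln\tfrac4\epsilon}+\frac{8(b-a)}{3(n-1)}\ln\tfrac4\epsilon,$$ and let $\delta(x^n,\epsilon,\boldsymbol\eta)=\delta_1$ if $n=1$ and $\delta(x^n,\epsilon,\boldsymbol\eta)=\min\{\delta_1,\delta_2\}$ if $n\ge2$. Finally, for noise parameters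 $\boldsymbol\eta'$ put $$\tilde\delta(x^n,\epsilon,\boldsymbol\eta')=\max_{\boldsymbol\eta\in E}\left\{\left|\phi^{\mathrm{LS}}_n(x^n,\boldsymbol\eta')-\phi^{\mathrm{LS}}_n(x^n,\boldsymbol\eta)\right|+\delta(x^n,\epsilon,\boldsymbol\eta)\right\}\in[0,\infty].$$ **Lemma 2.** For any number of trials $n\ge1$, any $0<\epsilon<1$, any true parameter $\phi\in\Phi$, any true noise parameters $\boldsymbol\eta\in E$ and any user-specified noise parameters $\boldsymbol\eta'$ (in $E$ or not): if $x_1,\dots,x_n$ are independent outcomes with distribution $p(\cdot\mid\phi,\boldsymbol\eta)$, then $$\left|\phi^{\mathrm{LS}}_n(x^n,\boldsymbol\eta')-\phi\right|\le\tilde\delta(x^n,\epsilon,\boldsymbol\eta')$$ holds with probability at least $1-\epsilon$ (that is, the event contains a measurable event of probability at least $1-\epsilon$). -/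

import Mathlib

open MeasureTheory ProbabilityTheory Set
open scoped InnerProductSpace

namespace Metrology

noncomputable section

/-! ### Quantum states, measurements and the Born rule -/

section Quantum

/-- Index set of a fixed orthonormal (Hilbert) basis of `H`. -/
def BasisIndex (H : Type*) [NormedAddCommGroup H] [InnerProductSpace ℂ H] [CompleteSpace H] :
    Set H :=
  (exists_hilbertBasis ℂ H).choose

/-- A fixed orthonormal (Hilbert) basis of `H`. -/
def stdBasis (H : Type*) [NormedAddCommGroup H] [InnerProductSpace ℂ H] [CompleteSpace H] :
    HilbertBasis (BasisIndex H) ℂ H :=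
  (exists_hilbertBasis ℂ H).choose_spec.choose

variable {H : Type*} [NormedAddCommGroup H] [InnerProductSpace ℂ H] [CompleteSpace H]

/-- The trace of a (trace class) operator. -/
def opTrace (T : H →L[ℂ] H) : ℂ :=
  ∑' i, ⟪stdBasis H i, T (stdBasis H i)⟫_ℂ

variable (H) in
/-- A quantum state: a positive operator of trace one. -/
structure DensityOperator where
  op : H →L[ℂ] H
  isPositive : op.IsPositive
  hasSum_trace : HasSum (fun i => ⟪stdBasis H i, op (stdBasis H i)⟫_ℂ) 1

variable (H) in
/-- A positive operator-valued measure on the real line whose outcomes lie in `[a, b]`.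
A discrete POVM `(Π_x)_{x ∈ 𝒳}`, `𝒳 ⊆ [a, b]`, is the case `effect B = ∑_{x ∈ 𝒳 ∩ B} Π_x`. -/
structure POVM (a b : ℝ) where
  effect : Set ℝ → H →L[ℂ] H
  isPositive : ∀ B, MeasurableSet B → (effect B).IsPositive
  effect_univ : effect univ = 1
  effect_compl_Icc : effect (Icc a b)ᶜ = 0
  hasSum_iUnion : ∀ B : ℕ → Set ℝ, (∀ k, MeasurableSet (B k)) →
    Pairwise (Function.onFun Disjoint B) →
    ∀ ψ : H, HasSum (fun k => ⟪ψ, effect (B k) ψ⟫_ℂ) ⟪ψ, effect (⋃ k, B k) ψ⟫_ℂ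

/-- The positive square root of a state. -/
def DensityOperator.sqrtOp (ρ : DensityOperator H) : H →L[ℂ] H := CFC.sqrt ρ.op

theorem DensityOperator.sqrtOp_mul (ρ : DensityOperator H) : ρ.sqrtOp * ρ.sqrtOp = ρ.op :=
  CFC.sqrt_mul_sqrt_self ρ.op (ContinuousLinearMap.nonneg_iff_isPositive _ |>.2 ρ.isPositive)

theorem DensityOperator.inner_sqrtOp (ρ : DensityOperator H) (x y : H) :
    ⟪ρ.sqrtOp x, y⟫_ℂ = ⟪x, ρ.sqrtOp y⟫_ℂ := by
  have h : ρ.sqrtOp.IsPositive :=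
    (ContinuousLinearMap.nonneg_iff_isPositive _).1 (CFC.sqrt_nonneg ρ.op)
  exact h.inner_left_eq_inner_right x y

theorem DensityOperator.summable_norm_sq (ρ : DensityOperator H) :
    Summable fun i => ‖ρ.sqrtOp (stdBasis H i)‖ ^ 2 := by
  have h := (Complex.hasSum_re ρ.hasSum_trace).summable
  refine h.congr fun i => ?_
  rw [← ρ.sqrtOp_mul, mul_apply_eq_comp, ← ρ.inner_sqrtOp,
    inner_self_eq_norm_sq_to_K]
  norm_cast

theorem summable_inner_sq (u : BasisIndex H → H) (hu : Summable fun i => ‖u i‖ ^ 2) :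
    Summable fun p : BasisIndex H × BasisIndex H => ‖⟪stdBasis H p.2, u p.1⟫_ℂ‖ ^ 2 := by
  have key : ∀ x : H, HasSum (fun j => ‖⟪stdBasis H j, x⟫_ℂ‖ ^ 2) (‖x‖ ^ 2) := by
    intro x
    have h := Complex.hasSum_re ((stdBasis H).hasSum_inner_mul_inner x x)
    rw [inner_self_eq_norm_sq_to_K] at h
    convert h using 1
    · ext j
      rw [← inner_conj_symm x (stdBasis H j), ← Complex.normSq_eq_conj_mul_self,
        Complex.ofReal_re, Complex.normSq_eq_norm_sq]
    · norm_cast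
  rw [summable_prod_of_nonneg (fun _ => by positivity)]
  refine ⟨fun i => (key (u i)).summable, ?_⟩
  exact hu.congr fun i => ((key (u i)).tsum_eq).symm

/-- `Tr[ρ A] = ∑ᵢ ⟪√ρ eᵢ, A √ρ eᵢ⟫` for positive `A`. -/
theorem DensityOperator.opTrace_mul (ρ : DensityOperator H) {A : H →L[ℂ] H}
    (hA : A.IsPositive) :
    opTrace (ρ.op * A) =
      ∑' i, ⟪ρ.sqrtOp (stdBasis H i), A (ρ.sqrtOp (stdBasis H i))⟫_ℂ := by
  set e := stdBasis H
  set S := ρ.sqrtOp with hS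
  let F : BasisIndex H → BasisIndex H → ℂ :=
    fun i j => ⟪S (e i), e j⟫_ℂ * ⟪A (S (e j)), e i⟫_ℂ
  have h1 := summable_inner_sq (fun i => S (e i)) ρ.summable_norm_sq
  have h2 : Summable fun p : BasisIndex H × BasisIndex H =>
      ‖⟪e p.2, A (S (e p.1))⟫_ℂ‖ ^ 2 := by
    refine summable_inner_sq (fun i => A (S (e i))) ?_
    refine Summable.of_nonneg_of_le (fun _ => by positivity) (fun i => ?_)
      (ρ.summable_norm_sq.mul_left (‖A‖ ^ 2))
    rw [← mul_pow]
    gcongr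
    exact A.le_opNorm _
  have hF : Summable (Function.uncurry F) := by
    refine Summable.of_norm_bounded (h1.add ((Equiv.prodComm _ _).summable_iff.2 h2)) ?_
    rintro ⟨i, j⟩
    simp only [Function.uncurry, F, norm_mul, Function.comp, Equiv.prodComm_apply, Prod.swap]
    rw [norm_inner_symm (S (e i)), norm_inner_symm (A _)]
    nlinarith [sq_nonneg (‖⟪e j, S (e i)⟫_ℂ‖ - ‖⟪e i, A (S (e j))⟫_ℂ‖),
      sq_nonneg (‖⟪e j, S (e i)⟫_ℂ‖), sq_nonneg (‖⟪e i, A (S (e j))⟫_ℂ‖)]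
  have hrow : ∀ i, ∑' j, F i j = ⟪e i, (ρ.op * A) (e i)⟫_ℂ := by
    intro i
    have := e.tsum_inner_mul_inner (S (e i)) (S (A (e i)))
    rw [ρ.inner_sqrtOp, ← mul_apply_eq_comp, ← mul_apply_eq_comp,
      ← mul_assoc, ρ.sqrtOp_mul] at this
    rw [← this]
    refine tsum_congr fun j => ?_
    simp only [F]
    rw [hA.inner_left_eq_inner_right, ρ.inner_sqrtOp (e j)]
    rfl
  have hcol : ∀ j, ∑' i, F i j = ⟪S (e j), A (S (e j))⟫_ℂ := by
    intro j
    have := e.tsum_inner_mul_inner (A (S (e j))) (S (e j))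
    rw [hA.inner_left_eq_inner_right] at this
    rw [← this]
    refine tsum_congr fun i => ?_
    simp only [F]
    rw [ρ.inner_sqrtOp (e i), mul_comm]
  unfold opTrace
  calc _ = ∑' i, ∑' j, F i j := tsum_congr fun i => (hrow i).symm
    _ = ∑' j, ∑' i, F i j := hF.tsum_comm.symm
    _ = _ := tsum_congr hcol

theorem DensityOperator.ofReal_opTrace_mul (ρ : DensityOperator H) {A : H →L[ℂ] H}
    (hA : A.IsPositive) :
    ENNReal.ofReal (opTrace (ρ.op * A)).re =
      ∑' i, ENNReal.ofReal
        (⟪ρ.sqrtOp (stdBasis H i), A (ρ.sqrtOp (stdBasis H i))⟫_ℂ).re := by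
  have hs : Summable fun i => ⟪ρ.sqrtOp (stdBasis H i), A (ρ.sqrtOp (stdBasis H i))⟫_ℂ := by
    refine Summable.of_norm_bounded (ρ.summable_norm_sq.mul_left ‖A‖) fun i => ?_
    refine (norm_inner_le_norm _ _).trans ?_
    nlinarith [A.le_opNorm (ρ.sqrtOp (stdBasis H i)),
      norm_nonneg (ρ.sqrtOp (stdBasis H i))]
  rw [ρ.opTrace_mul hA, Complex.re_tsum hs, ENNReal.ofReal_tsum_of_nonneg]
  · exact fun i => hA.re_inner_nonneg_right _
  · exact (Complex.hasSum_re hs.hasSum).summable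

/-- The distribution of the outcome when the POVM `M` is measured on the state `ρ`, given by the
Born rule `B ↦ Tr[ρ M(B)]`. -/
def outcomeLaw {a b : ℝ} (ρ : DensityOperator H) (M : POVM H a b) : Measure ℝ :=
  Measure.ofMeasurable (fun B _ => ENNReal.ofReal (opTrace (ρ.op * M.effect B)).re)
    (by
      have h0 : M.effect ∅ = 0 := by
        have h := M.hasSum_iUnion (fun _ => ∅) (fun _ => MeasurableSet.empty)
          (fun _ _ _ => by simp [Function.onFun])
        have h' : ∀ ψ : H, ⟪ψ, M.effect ∅ ψ⟫_ℂ = 0 := fun ψ =>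
          (summable_const_iff _).1 (h ψ).summable
        refine ContinuousLinearMap.ext fun ψ => ?_
        have h2 : ((M.effect ∅ : H →L[ℂ] H) : H →ₗ[ℂ] H) = 0 := by
          rw [← inner_map_self_eq_zero]
          intro x
          rw [← inner_conj_symm]
          simp [h' x]
        exact LinearMap.congr_fun h2 ψ
      simp [h0, opTrace])
    (by
      intro B hB hd
      rw [ρ.ofReal_opTrace_mul (M.isPositive _ (MeasurableSet.iUnion hB))]
      simp_rw [ρ.ofReal_opTrace_mul (M.isPositive _ (hB _))]
      rw [ENNReal.tsum_comm]
      refine tsum_congr fun i => ?_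
      have h := Complex.hasSum_re (M.hasSum_iUnion B hB hd (ρ.sqrtOp (stdBasis H i)))
      rw [← h.tsum_eq, ENNReal.ofReal_tsum_of_nonneg _ h.summable]
      exact fun k => (M.isPositive _ (hB k)).re_inner_nonneg_right _)

end Quantum

/-! ### The metrology experiment with noise parameters -/

/-- A metrology experiment with probe space `H`, parameter of interest `φ ∈ [phiMin, phiMax]` and
noise parameters `η = (η₁, η₂, η₃)` of the preparation, the dynamics and the measurement.  The
dynamics may be any map from states to states. -/
structure Model (H : Type*) [NormedAddCommGroup H] [InnerProductSpace ℂ H] [CompleteSpace H]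
    (T₁ T₂ T₃ : Type*) where
  a : ℝ
  b : ℝ
  phiMin : ℝ
  phiMax : ℝ
  phiMin_lt_phiMax : phiMin < phiMax
  state : T₁ → DensityOperator H
  process : ℝ → T₂ → DensityOperator H → DensityOperator H
  measurement : T₃ → POVM H a b

/-! ### Statistics of the data `x = (x₁, …, xₙ)` -/

/-- The sample mean `Sₙ`. -/
def sampleMean {n : ℕ} (x : Fin n → ℝ) : ℝ := (1 / (n : ℝ)) * ∑ i, x i

/-- The unbiased sample variance `Vₙ` (used for `n ≥ 2` only). -/
def sampleVariance {n : ℕ} (x : Fin n → ℝ) : ℝ :=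
  (1 / ((n : ℝ) - 1)) * ∑ i, (x i - sampleMean x) ^ 2

/-- `t ∈ Φ` minimizes `t' ↦ |Sₙ - f t'|` over `Φ`. -/
def IsLeastSquares (Φ : Set ℝ) (f : ℝ → ℝ) {n : ℕ} (x : Fin n → ℝ) (t : ℝ) : Prop :=
  t ∈ Φ ∧ ∀ t' ∈ Φ, |sampleMean x - f t| ≤ |sampleMean x - f t'|

/-- The least squares estimate: the minimizer of `t' ↦ |Sₙ - f t'|` over `Φ`, which exists and is
unique if `Φ` is a compact interval and `f` is continuous and injective on it. -/
def leastSquares (Φ : Set ℝ) (f : ℝ → ℝ) {n : ℕ} (x : Fin n → ℝ) : ℝ :=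
  Classical.epsilon (IsLeastSquares Φ f x)

namespace Model

variable {H : Type*} [NormedAddCommGroup H] [InnerProductSpace ℂ H] [CompleteSpace H]
  {T₁ T₂ T₃ : Type*}

/-- The parameter interval `Φ`. -/
def Phi (M : Model H T₁ T₂ T₃) : Set ℝ := Icc M.phiMin M.phiMax

/-- The distribution of a single outcome,
`B ↦ Tr[κ_{φ,η₂}(ρ_{η₁}) Π_{η₃}(B)]`. -/
def law (M : Model H T₁ T₂ T₃) (φ : ℝ) (η : T₁ × T₂ × T₃) : Measure ℝ :=
  outcomeLaw (M.process φ η.2.1 (M.state η.1)) (M.measurement η.2.2)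

/-- The expectation of a single outcome as a function of `φ`. -/
def f (M : Model H T₁ T₂ T₃) (η : T₁ × T₂ × T₃) (φ : ℝ) : ℝ := ∫ x, x ∂(M.law φ η)

/-- The derivative of `f` on the interval `Φ` (one-sided at the end points). -/
def df (M : Model H T₁ T₂ T₃) (η : T₁ × T₂ × T₃) (φ : ℝ) : ℝ := derivWithin (M.f η) M.Phi φ

/-- The second derivative of `f` on the interval `Φ`. -/
def ddf (M : Model H T₁ T₂ T₃) (η : T₁ × T₂ × T₃) (φ : ℝ) : ℝ := derivWithin (M.df η) M.Phi φ

/-- The set of values of `|(f')⁻³ f''|` on `Φ`. -/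
def curvatures (M : Model H T₁ T₂ T₃) (η : T₁ × T₂ × T₃) : Set ℝ :=
  (fun t => |((M.df η t) ^ 3)⁻¹ * M.ddf η t|) '' M.Phi

/-- The constant `L`, the largest value of `|(f')⁻³ f''|` on `Φ`. -/
def L (M : Model H T₁ T₂ T₃) (η : T₁ × T₂ × T₃) : ℝ := sSup (M.curvatures η)

/-- The standing assumptions at the noise parameter `η`: on `Φ`, the expectation `f` is injective
and twice differentiable, its derivative has no zero, and `L` is finite. -/
structure Admissible (M : Model H T₁ T₂ T₃) (η : T₁ × T₂ × T₃) : Prop where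
  injOn : InjOn (M.f η) M.Phi
  differentiableOn : DifferentiableOn ℝ (M.f η) M.Phi
  differentiableOn_df : DifferentiableOn ℝ (M.df η) M.Phi
  df_ne_zero : ∀ t ∈ M.Phi, M.df η t ≠ 0
  bddAbove : BddAbove (M.curvatures η)

/-- The least squares estimate computed with the noise parameter `η`. -/
def phiLS (M : Model H T₁ T₂ T₃) {n : ℕ} (x : Fin n → ℝ) (η : T₁ × T₂ × T₃) : ℝ :=
  leastSquares M.Phi (M.f η) x

/-- `V_max = (b - a)² / 4`. -/
def Vmax (M : Model H T₁ T₂ T₃) : ℝ := (M.b - M.a) ^ 2 / 4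

def delta₁ (M : Model H T₁ T₂ T₃) {n : ℕ} (x : Fin n → ℝ) (ε : ℝ) (η : T₁ × T₂ × T₃) : ℝ :=
  1 / |M.df η (M.phiLS x η)| * Real.sqrt (2 / (n : ℝ) * M.Vmax * Real.log (2 / ε))
    + M.L η / (n : ℝ) * M.Vmax * Real.log (2 / ε)

/-- The empirical Bernstein deviation `√((2/n) Vₙ ln(4/ε)) + 8(b-a)/(3(n-1)) ln(4/ε)`. -/
def bernsteinRadius (M : Model H T₁ T₂ T₃) {n : ℕ} (x : Fin n → ℝ) (ε : ℝ) : ℝ :=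
  Real.sqrt (2 / (n : ℝ) * sampleVariance x * Real.log (4 / ε))
    + 8 * (M.b - M.a) / (3 * ((n : ℝ) - 1)) * Real.log (4 / ε)

def delta₂ (M : Model H T₁ T₂ T₃) {n : ℕ} (x : Fin n → ℝ) (ε : ℝ) (η : T₁ × T₂ × T₃) : ℝ :=
  1 / |M.df η (M.phiLS x η)| * M.bernsteinRadius x ε
    + M.L η / 2 * (M.bernsteinRadius x ε) ^ 2

/-- The error bar `δ(x, ε, η)` for a known noise parameter `η`. -/
def delta (M : Model H T₁ T₂ T₃) {n : ℕ} (x : Fin n → ℝ) (ε : ℝ) (η : T₁ × T₂ × T₃) : ℝ :=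
  if n = 1 then M.delta₁ x ε η else min (M.delta₁ x ε η) (M.delta₂ x ε η)

/-- The error bar `δ̃(x, ε, η')` for a noise parameter only known to lie in `E`.  The supremum is
taken in the extended reals; it is the maximum whenever the maximum exists. -/
def deltaTilde (M : Model H T₁ T₂ T₃) (E : Set (T₁ × T₂ × T₃)) {n : ℕ} (x : Fin n → ℝ) (ε : ℝ)
    (η' : T₁ × T₂ × T₃) : EReal :=
  ⨆ η ∈ E, ((|M.phiLS x η' - M.phiLS x η| + M.delta x ε η : ℝ) : EReal)

end Model

/-- The event `A` holds with `P`-probability at least `p`; if `A` is not measurable, this means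
that it contains a measurable event of probability at least `p`. -/
def HoldsWithProbAtLeast {Ω : Type*} [MeasurableSpace Ω] (P : Measure Ω) (p : ℝ) (A : Set Ω) :
    Prop :=
  ∃ A₀ ⊆ A, MeasurableSet A₀ ∧ ENNReal.ofReal p ≤ P A₀

end

end Metrology

namespace Metrology

/-! ### Error propagation through the inverse of a monotone function -/

/-! The term of the supremum `deltaTilde` at the true `η`, with the triangle inequality, reduces the
claim to `|phiLS x η - φ| ≤ delta x ε η` with probability at least `1 - ε`; nothing about `phiLS x
η'` is needed.

Deterministic half (`Admissible.abs_phiLS_sub_le`): the inverse of `f` has first derivative `1 / f'`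
and second derivative `-f'' / f' ^ 3`, bounded by `L`. Its second order Taylor estimate turns a
deviation `r` of the sample mean into the error `r / |f'| + L r² / 2`.

Probabilistic half (`IsCenteredSample.measureReal_simultaneous_le`): since `delta` is a minimum,
Hoeffding's bound and the empirical Bernstein bound must hold together. Plain Hoeffding at `l = ln
(2/ε)` already spends all of `ε`, so a union bound is too weak. Rescale the outcomes to an interval
of length one, let `σ²` be their variance, put `u = ln (4/ε)`, `w = (l + u) / 2`, and compare the
Bernstein radius at level `w` with Hoeffding's. If Bernstein's is the smaller one, leaving it costs
`2 exp (-w) = ε / √2`, and failure of the empirical bound inside it costs at most `exp (-u) = ε /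
4`. If Hoeffding's is smaller, a cosh version of Hoeffding's inequality saves a second order term in
`ε`, and failure of the empirical bound inside costs only `exp (-2u) = ε² / 16`. The inner events
are rare because there the sample variance lies well below `σ²`; the lower tail of `∑ Yᵢ²`, governed
by the fourth moment, controls this. -/

theorem antitoneOn_inv_sub_mul {D : Set ℝ} (hD : Convex ℝ D) {f f' f'' : ℝ → ℝ} {L : ℝ}
    (hf : ∀ t ∈ D, HasDerivWithinAt f (f' t) D t)
    (hf' : ∀ t ∈ D, HasDerivWithinAt f' (f'' t) D t) (hpos : ∀ t ∈ D, 0 < f' t)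
    (hL : ∀ t ∈ D, -f'' t ≤ L * f' t ^ 3) :
    AntitoneOn (fun t => (f' t)⁻¹ - L * f t) D := by
  have hder : ∀ t ∈ D, HasDerivWithinAt (fun t => (f' t)⁻¹ - L * f t)
      (-f'' t / f' t ^ 2 - L * f' t) D t := fun t ht =>
    ((hf' t ht).fun_inv (hpos t ht).ne').sub ((hf t ht).const_mul L)
  refine antitoneOn_of_hasDerivWithinAt_nonpos hD (fun t ht => (hder t ht).continuousWithinAt)
    (fun t ht => (hder t (interior_subset ht)).mono interior_subset) fun t ht => ?_
  have ht := interior_subset ht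
  have h1 := hpos t ht
  rw [sub_nonpos, div_le_iff₀ (by positivity)]
  linarith [hL t ht]

/-- In the coordinate `y = f x`, `hanti` says that the derivative `1 / f'` of the inverse grows with
slope at most `L`. Monotonicity of `k` replaces integration, so neither the inverse nor
integrability of `f''` enters. -/
theorem sub_le_of_antitoneOn_inv_sub_mul {D : Set ℝ} (hD : Convex ℝ D) {f f' : ℝ → ℝ} {L : ℝ}
    (hf : ∀ t ∈ D, HasDerivWithinAt f (f' t) D t) (hpos : ∀ t ∈ D, 0 < f' t)
    (hanti : AntitoneOn (fun t => (f' t)⁻¹ - L * f t) D) {s t : ℝ} (hs : s ∈ D) (ht : t ∈ D)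
    (hst : s ≤ t) :
    t - s ≤ (f' s)⁻¹ * (f t - f s) + L / 2 * (f t - f s) ^ 2 := by
  have hsub : Icc s t ⊆ D := hD.ordConnected.out hs ht
  let k : ℝ → ℝ := fun x => (f' s)⁻¹ * (f x - f s) + L / 2 * (f x - f s) ^ 2 - x
  have hder : ∀ x ∈ Icc s t, HasDerivWithinAt k
      ((f' s)⁻¹ * f' x + L / 2 * (2 * (f x - f s) * f' x) - 1) (Icc s t) x := fun x hx => by
    have h0 := ((hf x (hsub hx)).mono hsub).sub_const (f s)
    have h1 := (h0.const_mul (f' s)⁻¹).add ((h0.pow 2).const_mul (L / 2))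
    have h2 := h1.sub (hasDerivWithinAt_id x _)
    refine h2.congr_deriv ?_
    simp
  -- The derivative of `k` is `f' x * ((f' s)⁻¹ + L * (f x - f s) - (f' x)⁻¹)`, nonnegative by
  -- `hanti`.
  have hmono : MonotoneOn k (Icc s t) := by
    refine monotoneOn_of_hasDerivWithinAt_nonneg (convex_Icc s t)
      (fun x hx => (hder x hx).continuousWithinAt)
      (fun x hx => (hder x (interior_subset hx)).mono interior_subset) fun x hx => ?_
    have hx := interior_subset hx
    have h1 := hpos x (hsub hx)
    have h2 := hanti hs (hsub hx) hx.1
    have h3 := mul_le_mul_of_nonneg_right h2 h1.le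
    have h4 : (f' x)⁻¹ * f' x = 1 := inv_mul_cancel₀ h1.ne'
    simp only [sub_mul, h4] at h3
    linarith
  have := hmono (left_mem_Icc.2 hst) (right_mem_Icc.2 hst) hst
  simp only [k, sub_self, ne_eq, OfNat.ofNat_ne_zero, not_false_eq_true, zero_pow, mul_zero,
    add_zero] at this
  linarith

theorem sub_le_of_deriv_pos {D : Set ℝ} (hD : Convex ℝ D) {f f' f'' : ℝ → ℝ} {L : ℝ}
    (hf : ∀ t ∈ D, HasDerivWithinAt f (f' t) D t)
    (hf' : ∀ t ∈ D, HasDerivWithinAt f' (f'' t) D t) (hpos : ∀ t ∈ D, 0 < f' t)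
    (hL : ∀ t ∈ D, |f'' t| ≤ L * f' t ^ 3) {s t : ℝ} (hs : s ∈ D) (ht : t ∈ D) :
    |t - s| ≤ 1 / |f' s| * |f t - f s| + L / 2 * |f t - f s| ^ 2 := by
  rw [one_div, abs_of_pos (hpos s hs), sq_abs]
  rcases le_total s t with hst | hst
  · have h := sub_le_of_antitoneOn_inv_sub_mul hD hf hpos
      (antitoneOn_inv_sub_mul hD hf hf' hpos fun t ht => (neg_le_abs _).trans (hL t ht)) hs ht hst
    rw [abs_of_nonneg (sub_nonneg.2 hst)]
    refine h.trans ?_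
    have := mul_le_mul_of_nonneg_left (le_abs_self (f t - f s)) (inv_nonneg.2 (hpos s hs).le)
    linarith
  -- The reflection `x ↦ -f (-x)` keeps the derivative positive and swaps the order of `s` and `t`.
  -- It flips the sign of `f''`, which is why `hL` bounds `|f''|`.
  · have hr : ∀ {g g' : ℝ → ℝ}, (∀ t ∈ D, HasDerivWithinAt g (g' t) D t) →
        ∀ t ∈ -D, HasDerivWithinAt (fun x => g (-x)) (-g' (-t)) (-D) t := by
      intro g g' h t ht
      have := (h (-t) ht).comp t (hasDerivWithinAt_neg t (-D)) (fun x hx => hx)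
      refine this.congr_deriv (by simp)
    have hfr : ∀ t ∈ -D, HasDerivWithinAt (fun x => -f (-x)) (f' (-t)) (-D) t :=
      fun t ht => (hr hf t ht).neg.congr_deriv (by simp)
    have hpos' : ∀ t ∈ -D, 0 < f' (-t) := fun t ht => hpos _ ht
    have h := sub_le_of_antitoneOn_inv_sub_mul hD.neg hfr hpos'
      (antitoneOn_inv_sub_mul (L := L) hD.neg hfr (hr hf') hpos'
        (fun t ht => by simpa using (le_abs_self _).trans (hL (-t) ht)))
      (s := -s) (t := -t) (by simpa using hs) (by simpa using ht) (neg_le_neg hst)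
    simp only [neg_neg] at h
    rw [abs_of_nonpos (sub_nonpos.2 hst)]
    have := mul_le_mul_of_nonneg_left (neg_le_abs (f t - f s)) (inv_nonneg.2 (hpos s hs).le)
    have h2 : (-f t - -f s) ^ 2 = (f t - f s) ^ 2 := by ring
    rw [h2] at h
    linarith

/-- If `f'` has no zero and `|f'' / f' ^ 3| ≤ L`, the distance of two points is bounded by the
second order expansion of the inverse of `f`. -/
theorem abs_sub_le_of_deriv_ne_zero {D : Set ℝ} (hD : Convex ℝ D) {f f' f'' : ℝ → ℝ} {L : ℝ}
    (hf : ∀ t ∈ D, HasDerivWithinAt f (f' t) D t)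
    (hf' : ∀ t ∈ D, HasDerivWithinAt f' (f'' t) D t) (h0 : ∀ t ∈ D, f' t ≠ 0)
    (hL : ∀ t ∈ D, |(f' t ^ 3)⁻¹ * f'' t| ≤ L) {s t : ℝ} (hs : s ∈ D) (ht : t ∈ D) :
    |t - s| ≤ 1 / |f' s| * |f t - f s| + L / 2 * |f t - f s| ^ 2 := by
  have hL' : ∀ t ∈ D, |f'' t| ≤ L * |f' t| ^ 3 := fun t ht => by
    have h1 := hL t ht
    rw [abs_mul, abs_inv, abs_pow, inv_mul_le_iff₀ (by have := h0 t ht; positivity)] at h1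
    linarith
  rcases hasDerivWithinAt_forall_lt_or_forall_gt_of_forall_ne hD hf h0 with h | h
  · have := sub_le_of_deriv_pos hD (f := fun x => -f x) (f' := fun x => -f' x)
      (f'' := fun x => -f'' x) (L := L) (fun t ht => (hf t ht).neg) (fun t ht => (hf' t ht).neg)
      (fun t ht => neg_pos.2 (h t ht))
      (fun t ht => by have := hL' t ht; rwa [abs_of_neg (h t ht), ← abs_neg] at this) hs ht
    have e : |-f t - -f s| = |f t - f s| := by rw [← abs_neg]; congr 1; ring
    rwa [abs_neg, e] at this
  · exact sub_le_of_deriv_pos hD hf hf' h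
      (fun t ht => by have := hL' t ht; rwa [abs_of_pos (h t ht)] at this) hs ht

/-! ### The least squares estimate -/

theorem exists_isLeastSquares {Φ : Set ℝ} (hΦ : IsCompact Φ) (hne : Φ.Nonempty) {f : ℝ → ℝ}
    (hf : ContinuousOn f Φ) {n : ℕ} (x : Fin n → ℝ) : ∃ t, IsLeastSquares Φ f x t := by
  obtain ⟨t, ht, hmin⟩ := hΦ.exists_isMinOn hne
    (f := fun t => |sampleMean x - f t|) (continuousOn_const.sub hf).abs
  exact ⟨t, ht, fun t' ht' => hmin ht'⟩

theorem isLeastSquares_leastSquares {Φ : Set ℝ} (hΦ : IsCompact Φ) (hne : Φ.Nonempty)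
    {f : ℝ → ℝ} (hf : ContinuousOn f Φ) {n : ℕ} (x : Fin n → ℝ) :
    IsLeastSquares Φ f x (leastSquares Φ f x) :=
  Classical.epsilon_spec (exists_isLeastSquares hΦ hne hf x)

/-- `f '' Φ` is an interval and `f t` is its point nearest to the sample mean, so `f t` lies between
the mean and `f s`. The triangle inequality alone would lose a factor 2. -/
theorem IsLeastSquares.abs_sub_le {Φ : Set ℝ} (hΦ : IsPreconnected Φ) {f : ℝ → ℝ}
    (hf : ContinuousOn f Φ) {n : ℕ} {x : Fin n → ℝ} {t s : ℝ} (ht : IsLeastSquares Φ f x t)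
    (hs : s ∈ Φ) : |f s - f t| ≤ |sampleMean x - f s| := by
  have hI : OrdConnected (f '' Φ) := (hΦ.image f hf).ordConnected
  set m := sampleMean x
  by_contra! hlt
  have hts := ht.2 s hs
  have key : ∀ y, y ∈ uIcc (f s) (f t) → |m - f t| ≤ |m - y| := fun y hy => by
    obtain ⟨r, hr, rfl⟩ := hI.uIcc_subset (mem_image_of_mem f hs) (mem_image_of_mem f ht.1) hy
    exact ht.2 r hr
  rcases le_total (f s) (f t) with h | h
  · rw [uIcc_of_le h] at key
    rw [abs_of_nonpos (sub_nonpos.2 h)] at hlt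
    have h1 := abs_lt.1 hlt
    -- The mean clamped to the interval is an attained value, and it would be nearer to the mean
    -- than `f t`.
    have h2 := key (max m (f s)) ⟨le_max_right _ _, max_le (by linarith) h⟩
    rw [abs_of_neg (show m - f t < 0 by linarith)] at h2
    rcases le_total m (f s) with h3 | h3
    · rw [max_eq_right h3, abs_of_nonpos (by linarith)] at h2
      linarith [neg_le_abs (m - f s)]
    · rw [max_eq_left h3] at h2
      simp at h2
      linarith
  · rw [uIcc_of_ge h] at key
    rw [abs_of_nonneg (sub_nonneg.2 h)] at hlt
    have h1 := abs_lt.1 hlt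
    have h2 := key (min m (f s)) ⟨le_min (by linarith) h, min_le_right _ _⟩
    rw [abs_of_pos (show 0 < m - f t by linarith)] at h2
    rcases le_total m (f s) with h3 | h3
    · rw [min_eq_left h3] at h2
      simp at h2
      linarith
    · rw [min_eq_right h3, abs_of_nonneg (by linarith)] at h2
      linarith [le_abs_self (m - f s)]

namespace Model

variable {H : Type*} [NormedAddCommGroup H] [InnerProductSpace ℂ H] [CompleteSpace H]
  {T₁ T₂ T₃ : Type*} {M : Model H T₁ T₂ T₃} {η : T₁ × T₂ × T₃}

theorem Admissible.L_nonneg (h : M.Admissible η) : 0 ≤ M.L η := by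
  have hmem : M.phiMin ∈ M.Phi := left_mem_Icc.2 M.phiMin_lt_phiMax.le
  exact (abs_nonneg _).trans (le_csSup h.bddAbove (mem_image_of_mem _ hmem))

/-- A deviation of the sample mean of at most `r` from its expectation translates into an error of
the least squares estimate. -/
theorem Admissible.abs_phiLS_sub_le (h : M.Admissible η) {n : ℕ} {x : Fin n → ℝ} {φ r : ℝ}
    (hφ : φ ∈ M.Phi) (hr : |sampleMean x - M.f η φ| ≤ r) :
    |M.phiLS x η - φ| ≤ 1 / |M.df η (M.phiLS x η)| * r + M.L η / 2 * r ^ 2 := by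
  have hcont := h.differentiableOn.continuousOn
  have hls : IsLeastSquares M.Phi (M.f η) x (M.phiLS x η) :=
    isLeastSquares_leastSquares isCompact_Icc ⟨φ, hφ⟩ hcont x
  have h1 := (hls.abs_sub_le (convex_Icc _ _).isPreconnected hcont hφ).trans hr
  have h2 := abs_sub_le_of_deriv_ne_zero (convex_Icc _ _)
    (fun t ht => (h.differentiableOn t ht).hasDerivWithinAt)
    (fun t ht => (h.differentiableOn_df t ht).hasDerivWithinAt) h.df_ne_zero
    (fun t ht => le_csSup h.bddAbove (mem_image_of_mem _ ht)) hls.1 hφ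
  rw [abs_sub_comm]
  refine h2.trans ?_
  have := h.L_nonneg
  exact add_le_add (mul_le_mul_of_nonneg_left h1 (by positivity))
    (mul_le_mul_of_nonneg_left (pow_le_pow_left₀ (abs_nonneg _) h1 2) (by positivity))

end Model

/-! ### Elementary bounds for the exponential function -/

/-- `(1 - x + x²/2) * (1 + x + x²/2) = 1 + x⁴/4 ≥ 1`. -/
theorem exp_neg_le_quadratic {x : ℝ} (hx : 0 ≤ x) : Real.exp (-x) ≤ 1 - x + x ^ 2 / 2 := by
  have h := Real.quadratic_le_exp_of_nonneg hx
  rw [Real.exp_neg, inv_le_iff_one_le_mul₀ (Real.exp_pos x)]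
  have h2 : 0 ≤ 1 - x + x ^ 2 / 2 := by nlinarith [sq_nonneg (x - 1)]
  have := mul_le_mul_of_nonneg_left h h2
  nlinarith [sq_nonneg (x ^ 2)]

/-- Since `(k + 2)! ≥ 2 * 3 ^ k`, the exponential series from order two on is dominated by a
geometric one. -/
theorem exp_le_one_add_add_sq_div {x c : ℝ} (hx : |x| ≤ c) (hc : c < 3) :
    Real.exp x ≤ 1 + x + x ^ 2 / (2 * (1 - c / 3)) := by
  have hc0 : 0 ≤ c := (abs_nonneg x).trans hx
  have h1 : HasSum (fun k : ℕ => x ^ k / k.factorial) (Real.exp x) := by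
    rw [Real.exp_eq_exp_ℝ]
    exact NormedSpace.expSeries_div_hasSum_exp x
  have h2 := (hasSum_nat_add_iff' 2).2 h1
  have h3 : HasSum (fun k : ℕ => x ^ 2 / 2 * (c / 3) ^ k) (x ^ 2 / 2 * (1 - c / 3)⁻¹) :=
    (hasSum_geometric_of_lt_one (by positivity) (by linarith)).mul_left _
  have h4 := hasSum_le (fun k => ?_) h2 h3
  · simp only [Finset.sum_range_succ, Finset.sum_range_zero, pow_zero, Nat.factorial_zero,
      Nat.cast_one, pow_one, Nat.factorial_one, div_one, zero_add] at h4
    have : x ^ 2 / 2 * (1 - c / 3)⁻¹ = x ^ 2 / (2 * (1 - c / 3)) := by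
      rw [← div_eq_mul_inv, div_div]
    linarith
  · have hfac : (2 * 3 ^ k : ℝ) ≤ ((k + 2).factorial : ℝ) := by
      have := @Nat.factorial_mul_pow_le_factorial 2 k
      rw [add_comm 2 k] at this
      exact_mod_cast this
    calc x ^ (k + 2) / ((k + 2).factorial : ℝ) ≤ |x| ^ (k + 2) / ((k + 2).factorial : ℝ) :=
          div_le_div_of_nonneg_right ((le_abs_self _).trans (abs_pow x (k + 2)).le) (by positivity)
      _ ≤ |x| ^ (k + 2) / (2 * 3 ^ k) := by gcongr
      _ = x ^ 2 / 2 * (|x| / 3) ^ k := by rw [pow_add, sq_abs, div_pow]; field_simp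
      _ ≤ x ^ 2 / 2 * (c / 3) ^ k := by gcongr

/-! ### Concentration of bounded independent random variables -/

section Concentration

variable {Ω : Type*} [MeasurableSpace Ω] {P : Measure Ω}

/-- Independent centered random variables with common variance `v`, which take their values in
the interval `[c, c + 1]`. -/
structure IsCenteredSample {n : ℕ} (Y : Fin n → Ω → ℝ) (P : Measure Ω) (c v : ℝ) : Prop where
  indep : iIndepFun Y P
  aemeasurable : ∀ i, AEMeasurable (Y i) P
  mem_Icc : ∀ i, ∀ᵐ ω ∂P, Y i ω ∈ Icc c (c + 1)
  integral_eq_zero : ∀ i, ∫ ω, Y i ω ∂P = 0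
  integral_sq : ∀ i, ∫ ω, Y i ω ^ 2 ∂P = v

namespace IsCenteredSample

variable {n : ℕ} {Y : Fin n → Ω → ℝ} {c v : ℝ}

theorem neg (h : IsCenteredSample Y P c v) :
    IsCenteredSample (fun i ω => -Y i ω) P (-c - 1) v where
  indep := h.indep.comp (fun _ x => -x) fun _ => measurable_neg
  aemeasurable i := (h.aemeasurable i).neg
  mem_Icc i := by
    filter_upwards [h.mem_Icc i] with ω hω
    constructor <;> linarith [hω.1, hω.2]
  integral_eq_zero i := by rw [integral_neg, h.integral_eq_zero, neg_zero]
  integral_sq i := by simpa using h.integral_sq i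

theorem variance_nonneg (h : IsCenteredSample Y P c v) (i : Fin n) : 0 ≤ v := by
  rw [← h.integral_sq i]
  exact integral_nonneg fun _ => sq_nonneg _

end IsCenteredSample

variable [IsProbabilityMeasure P]

theorem integrable_of_forall_abs_le {f : Ω → ℝ} (hf : AEMeasurable f P) (C : ℝ)
    (h : ∀ᵐ ω ∂P, |f ω| ≤ C) : Integrable f P :=
  Integrable.of_bound hf.aestronglyMeasurable C h

/-- The Chernoff bound for a sum of bounded independent random variables. -/
theorem measureReal_sum_ge_le_exp {n : ℕ} {Z : Fin n → Ω → ℝ} (hZ : iIndepFun Z P)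
    (hm : ∀ i, AEMeasurable (Z i) P) {a b : ℝ} (hb : ∀ i, ∀ᵐ ω ∂P, Z i ω ∈ Icc a b) {t A : ℝ}
    (ht : 0 ≤ t) (hA : ∀ i, mgf (Z i) P t ≤ Real.exp A) (x : ℝ) :
    P.real {ω | x ≤ ∑ i, Z i ω} ≤ Real.exp (-t * x + n * A) := by
  have hS : ∀ᵐ ω ∂P, (∑ i, Z i ω) ∈ Icc (n * a) (n * b) := by
    filter_upwards [ae_all_iff.2 hb] with ω hω
    constructor
    · simpa using Finset.card_nsmul_le_sum Finset.univ (fun i => Z i ω) a fun i _ => (hω i).1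
    · simpa using Finset.sum_le_card_nsmul Finset.univ (fun i => Z i ω) b fun i _ => (hω i).2
  have hSm : AEMeasurable (fun ω => ∑ i, Z i ω) P := by fun_prop
  have h1 := measure_ge_le_exp_mul_mgf x ht (integrable_exp_mul_of_mem_Icc hSm hS (t := t))
  have h2 := hZ.mgf_sum₀ (t := t) hm Finset.univ
  have h3 : (∑ i, Z i) = fun ω => ∑ i, Z i ω := by ext ω; simp
  rw [h3] at h2
  rw [h2] at h1
  refine h1.trans ?_
  rw [Real.exp_add]
  gcongr
  calc ∏ i, mgf (Z i) P t ≤ ∏ _i : Fin n, Real.exp A :=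
        Finset.prod_le_prod (fun _ _ => mgf_nonneg) fun i _ => hA i
    _ = Real.exp (n * A) := by simp [Real.exp_nat_mul]

namespace IsCenteredSample

variable {n : ℕ} {Y : Fin n → Ω → ℝ} {c v : ℝ}

theorem integrable (h : IsCenteredSample Y P c v) (i : Fin n) : Integrable (Y i) P :=
  integrable_of_forall_abs_le (h.aemeasurable i) (max |c| |c + 1|) <| by
    filter_upwards [h.mem_Icc i] with ω hω using abs_le_max_abs_abs hω.1 hω.2

theorem nonpos_and_nonneg (h : IsCenteredSample Y P c v) (i : Fin n) : c ≤ 0 ∧ 0 ≤ c + 1 := by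
  have h1 := integral_mono_ae (integrable_const c) (h.integrable i)
    ((h.mem_Icc i).mono fun ω hω => hω.1)
  have h2 := integral_mono_ae (h.integrable i) (integrable_const (c + 1))
    ((h.mem_Icc i).mono fun ω hω => hω.2)
  rw [h.integral_eq_zero] at h1 h2
  exact ⟨by simpa using h1, by simpa using h2⟩

theorem abs_le_one (h : IsCenteredSample Y P c v) (i : Fin n) : ∀ᵐ ω ∂P, |Y i ω| ≤ 1 := by
  have hc := h.nonpos_and_nonneg i
  filter_upwards [h.mem_Icc i] with ω hω
  exact abs_le.2 ⟨by linarith [hω.1, hc.2], by linarith [hω.2, hc.1]⟩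

theorem integrable_pow (h : IsCenteredSample Y P c v) (i : Fin n) (k : ℕ) :
    Integrable (fun ω => Y i ω ^ k) P :=
  integrable_of_forall_abs_le ((h.aemeasurable i).pow_const k) 1 <| by
    filter_upwards [h.abs_le_one i] with ω hω
    rw [abs_pow]
    exact pow_le_one₀ (abs_nonneg _) hω

/-- The Bhatia–Davis bound: take expectations in `(Y - c) * (c + 1 - Y) ≥ 0`. -/
theorem variance_le (h : IsCenteredSample Y P c v) (i : Fin n) : v ≤ -c * (c + 1) := by
  have h1 := integral_mono_ae (h.integrable_pow i 2)
    (((h.integrable i).const_mul (2 * c + 1)).add (integrable_const (-c * (c + 1)))) <| by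
      filter_upwards [h.mem_Icc i] with ω hω
      simp only [Pi.add_apply]
      nlinarith [mul_nonneg (sub_nonneg.2 hω.1) (sub_nonneg.2 hω.2)]
  rw [h.integral_sq, integral_add' ((h.integrable i).const_mul _) (integrable_const _),
    integral_const_mul, h.integral_eq_zero] at h1
  simpa using h1

theorem variance_le_quarter (h : IsCenteredSample Y P c v) (i : Fin n) : v ≤ 1 / 4 := by
  nlinarith [h.variance_le i, sq_nonneg (c + 1 / 2)]

theorem integral_pow_four_le_variance (h : IsCenteredSample Y P c v) (i : Fin n) :
    ∫ ω, Y i ω ^ 4 ∂P ≤ v := by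
  rw [← h.integral_sq i]
  refine integral_mono_ae (h.integrable_pow i 4) (h.integrable_pow i 2) ?_
  filter_upwards [h.abs_le_one i] with ω hω
  have h1 : Y i ω ^ 2 ≤ 1 := (sq_le_one_iff_abs_le_one _).2 hω
  nlinarith [sq_nonneg (Y i ω)]

/-- The fourth moment is at most that of a Bernoulli random variable of the same variance. -/
theorem integral_pow_four_le (h : IsCenteredSample Y P c v) (i : Fin n) (hv : 1 / 8 ≤ v) :
    ∫ ω, Y i ω ^ 4 ∂P ≤ v * (1 - 3 * v) := by
  set q := -c * (c + 1) with hq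
  have hvq : v ≤ q := h.variance_le i
  have hq4 : q ≤ 1 / 4 := by nlinarith [sq_nonneg (c + 1 / 2)]
  have hα : (2 * c + 1) ^ 2 = 1 - 4 * q := by rw [hq]; ring
  have i1 : Integrable (fun ω => (1 - 4 * q) * Y i ω ^ 2) P := (h.integrable_pow i 2).const_mul _
  have i2 : Integrable (fun ω => 2 * (2 * c + 1) * q * Y i ω) P := (h.integrable i).const_mul _
  have i3 : Integrable (fun _ : Ω => q ^ 2) P := integrable_const _
  have i12 : Integrable (fun ω => (1 - 4 * q) * Y i ω ^ 2 + 2 * (2 * c + 1) * q * Y i ω) P :=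
    i1.add i2
  have h1 : ∫ ω, Y i ω ^ 4 ∂P ≤
      ∫ ω, ((1 - 4 * q) * Y i ω ^ 2 + 2 * (2 * c + 1) * q * Y i ω) + q ^ 2 ∂P := by
    refine integral_mono_ae (h.integrable_pow i 4) (i12.add i3) ?_
    filter_upwards [h.mem_Icc i] with ω hω
    have h2 : Y i ω ^ 2 ≤ (2 * c + 1) * Y i ω + q := by
      rw [hq]
      nlinarith [mul_nonneg (sub_nonneg.2 hω.1) (sub_nonneg.2 hω.2)]
    have h3 := pow_le_pow_left₀ (sq_nonneg _) h2 2
    rw [← hα]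
    calc Y i ω ^ 4 = (Y i ω ^ 2) ^ 2 := by ring
      _ ≤ _ := h3
      _ = _ := by ring
  rw [integral_add i12 i3, integral_add i1 i2, integral_const_mul, integral_const_mul,
    h.integral_sq, h.integral_eq_zero] at h1
  simp only [mul_zero, add_zero, integral_const, probReal_univ, smul_eq_mul, one_mul] at h1
  -- The excess of `(1 - 4q) v + q²` over `v (1 - 3v)` is `(q - v) (q - 3v)`, and `v ≤ q ≤ 1/4 ≤
  -- 3v`.
  nlinarith [mul_nonneg (sub_nonneg.2 hvq) (show (0 : ℝ) ≤ 3 * v - q by linarith)]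

/-- Hoeffding's inequality, improved by the factor `(1 - exp (-l)) / (1 - exp (-2 * l)) ^ 2`. -/
theorem measureReal_hoeffding_le (h : IsCenteredSample Y P c v) (hn : 1 ≤ n) {l : ℝ}
    (hl : 0 < l) :
    P.real {ω | √(l / (2 * n)) < |sampleMean fun i => Y i ω|} ≤
      (Real.exp l - 1) / (Real.cosh (2 * l) - 1) := by
  have hn0 : (0 : ℝ) < n := by exact_mod_cast hn
  set t := √(l / (2 * n)) with ht
  have ht0 : 0 ≤ t := Real.sqrt_nonneg _
  have htt : n * t ^ 2 = l / 2 := by rw [Real.sq_sqrt (by positivity)]; field_simp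
  have hsub : HasSubgaussianMGF (fun ω => ∑ i, Y i ω) (∑ _i : Fin n, (‖c + 1 - c‖₊ / 2) ^ 2) P :=
    HasSubgaussianMGF.sum_of_iIndepFun h.indep fun i _ =>
      hasSubgaussianMGF_of_mem_Icc_of_integral_eq_zero (h.aemeasurable i) (h.mem_Icc i)
        (h.integral_eq_zero i)
  have hmgf : ∀ s : ℝ, s ^ 2 = (4 * t) ^ 2 → mgf (fun ω => ∑ i, Y i ω) P s ≤ Real.exp l := by
    intro s hs
    refine (hsub.mgf_le s).trans (Real.exp_le_exp.2 (le_of_eq ?_))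
    rw [hs]
    simp
    nlinarith
  -- Markov's inequality for `cosh - 1` treats both tails at once, and subtracting 1 gives the gain
  -- over Chernoff. On the event, `4t |∑ Yᵢ| ≥ 4nt² = 2l`, while both exponential moments are at
  -- most `exp l`.
  let g : Ω → ℝ := fun ω => Real.cosh (4 * t * ∑ i, Y i ω) - 1
  have e1 := hsub.integrable_exp_mul (4 * t)
  have e2 := hsub.integrable_exp_mul (-(4 * t))
  have hg : g = fun ω => (Real.exp (4 * t * ∑ i, Y i ω) + Real.exp (-(4 * t) * ∑ i, Y i ω)) / 2
      - 1 := by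
    ext ω
    simp only [g, Real.cosh_eq, neg_mul]
  have e3 : Integrable (fun ω => (Real.exp (4 * t * ∑ i, Y i ω) +
      Real.exp (-(4 * t) * ∑ i, Y i ω)) / 2) P := (e1.add e2).div_const 2
  have hgint : Integrable g P := by
    rw [hg]
    exact e3.sub (integrable_const 1)
  have hgle : ∫ ω, g ω ∂P ≤ Real.exp l - 1 := by
    rw [hg, integral_sub e3 (integrable_const 1), integral_div, integral_add e1 e2]
    have m1 := hmgf (4 * t) rfl
    have m2 := hmgf (-(4 * t)) (by ring)
    simp only [mgf] at m1 m2
    simp only [integral_const, probReal_univ, smul_eq_mul, one_mul]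
    linarith
  have hmarkov := mul_meas_ge_le_integral_of_nonneg (μ := P) (f := g)
    (ae_of_all _ fun ω => sub_nonneg.2 (Real.one_le_cosh _)) hgint (Real.cosh (2 * l) - 1)
  have hpos : 0 < Real.cosh (2 * l) - 1 := by
    have := Real.one_lt_cosh.2 (show 2 * l ≠ 0 by positivity)
    linarith
  rw [le_div_iff₀ hpos, mul_comm]
  refine le_trans ?_ (hmarkov.trans hgle)
  refine mul_le_mul_of_nonneg_left (measureReal_mono fun ω hω => ?_) hpos.le
  simp only [mem_ofPred_eq] at hω ⊢
  refine sub_le_sub_right (Real.cosh_le_cosh.2 ?_) 1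
  simp only [sampleMean, abs_mul, abs_div, abs_one, Nat.abs_cast] at hω
  rw [abs_mul (4 * t), abs_of_nonneg (show (0 : ℝ) ≤ 2 * l by positivity),
    abs_of_nonneg (show (0 : ℝ) ≤ 4 * t by positivity)]
  rw [one_div, inv_mul_eq_div, lt_div_iff₀ hn0] at hω
  nlinarith [mul_le_mul_of_nonneg_left hω.le ht0]

theorem mgf_le_exp (h : IsCenteredSample Y P c v) (i : Fin n) {s : ℝ} (hs0 : 0 ≤ s)
    (hs3 : s < 3) : mgf (Y i) P s ≤ Real.exp (v * (s ^ 2 / (2 * (1 - s / 3)))) := by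
  set k := s ^ 2 / (2 * (1 - s / 3)) with hk
  have i1 := (h.integrable i).const_mul s
  have i2 := (h.integrable_pow i 2).const_mul k
  have i12 : Integrable (fun ω => 1 + s * Y i ω) P := (integrable_const 1).add i1
  have h1 : mgf (Y i) P s ≤ ∫ ω, (1 + s * Y i ω) + k * Y i ω ^ 2 ∂P := by
    refine integral_mono_ae (integrable_exp_mul_of_mem_Icc (h.aemeasurable i) (h.mem_Icc i))
      (i12.add i2) ?_
    filter_upwards [h.abs_le_one i] with ω hω
    have := exp_le_one_add_add_sq_div (x := s * Y i ω) (c := s)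
      (by rw [abs_mul, abs_of_nonneg hs0]; nlinarith) hs3
    refine this.trans (le_of_eq ?_)
    simp only [hk]
    ring
  rw [integral_add i12 i2, integral_add (integrable_const 1) i1,
    integral_const_mul, integral_const_mul, h.integral_sq, h.integral_eq_zero] at h1
  simp only [mul_zero, add_zero, integral_const, probReal_univ, smul_eq_mul, mul_one] at h1
  refine h1.trans ?_
  have := Real.add_one_le_exp (v * k)
  linarith

theorem measureReal_sum_ge_bernstein (h : IsCenteredSample Y P c v) (hn : 1 ≤ n) {σ w : ℝ}
    (hσ : 0 < σ) (hv : v = σ ^ 2) (hw : 0 ≤ w) :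
    P.real {ω | n * (σ * √(2 * w / n) + w / (3 * n)) ≤ ∑ i, Y i ω} ≤ Real.exp (-w) := by
  have hn0 : (0 : ℝ) < n := by exact_mod_cast hn
  set s := √(2 * w / n) with hs
  have hs0 : 0 ≤ s := Real.sqrt_nonneg _
  have hss : n * s ^ 2 = 2 * w := by rw [Real.sq_sqrt (by positivity)]; field_simp
  have hd : 0 < 3 * σ + s := by positivity
  -- This `t` solves `t / (1 - t/3) = s / σ`; the exponent then equals `-w` exactly.
  refine (measureReal_sum_ge_le_exp h.indep h.aemeasurable h.mem_Icc
    (t := 3 * s / (3 * σ + s)) (by positivity) (fun i => h.mgf_le_exp i (by positivity) ?_)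
    _).trans (Real.exp_le_exp.2 (le_of_eq ?_))
  · rw [div_lt_iff₀ hd]
    linarith
  · have e1 : 1 - 3 * s / (3 * σ + s) / 3 = 3 * σ / (3 * σ + s) := by field_simp; ring
    have e2 : (3 * s / (3 * σ + s)) ^ 2 / (2 * (3 * σ / (3 * σ + s))) =
        3 * s ^ 2 / (2 * σ * (3 * σ + s)) := by field_simp
    have e3 : n * (σ * s + w / (3 * n)) = n * σ * s + w / 3 := by field_simp
    rw [e1, e2, e3, hv]
    have hw' : w = n * s ^ 2 / 2 := by linarith
    rw [hw']
    field_simp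
    ring

/-- Bernstein's inequality. -/
theorem measureReal_bernstein_le (h : IsCenteredSample Y P c v) (hn : 1 ≤ n) {σ w : ℝ}
    (hσ : 0 < σ) (hv : v = σ ^ 2) (hw : 0 ≤ w) :
    P.real {ω | σ * √(2 * w / n) + w / (3 * n) < |sampleMean fun i => Y i ω|} ≤
      2 * Real.exp (-w) := by
  have hn0 : (0 : ℝ) < n := by exact_mod_cast hn
  have h1 := h.measureReal_sum_ge_bernstein hn hσ hv hw
  have h2 := h.neg.measureReal_sum_ge_bernstein hn hσ hv hw
  rw [two_mul (Real.exp (-w))]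
  refine le_trans ?_ ((measureReal_union_le _ _).trans (add_le_add h1 h2))
  refine measureReal_mono fun ω hω => ?_
  simp only [mem_ofPred_eq, sampleMean, abs_mul, abs_div, abs_one, Nat.abs_cast] at hω
  rw [one_div, inv_mul_eq_div, lt_div_iff₀ hn0, lt_abs] at hω
  rcases hω with hω | hω
  · left
    simp only [mem_ofPred_eq]
    linarith
  · right
    simp only [mem_ofPred_eq, Finset.sum_neg_distrib]
    linarith

/-- The lower tail of the sum of squares. -/
theorem measureReal_sum_sq_le (h : IsCenteredSample Y P c v) {K τ x : ℝ} (hK : 0 < K)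
    (hK4 : ∀ i, ∫ ω, Y i ω ^ 4 ∂P ≤ K) (hτ : 0 ≤ τ) (hx : x ≤ n * (v - τ)) :
    P.real {ω | ∑ i, Y i ω ^ 2 ≤ x} ≤ Real.exp (-(n * (τ ^ 2 / (2 * K)))) := by
  -- `τ / K` minimizes the Chernoff exponent `-tτ + t²K/2`. As `-Y²` is nonpositive, second and
  -- fourth moments suffice.
  have hmgf : ∀ i, mgf (fun ω => -Y i ω ^ 2) P (τ / K) ≤
      Real.exp (-(τ / K) * v + (τ / K) ^ 2 / 2 * K) := fun i => by
    have i1 := (h.integrable_pow i 2).const_mul (-(τ / K))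
    have i2 := (h.integrable_pow i 4).const_mul ((τ / K) ^ 2 / 2)
    have i12 : Integrable (fun ω => 1 + -(τ / K) * Y i ω ^ 2) P := (integrable_const 1).add i1
    have h1 : mgf (fun ω => -Y i ω ^ 2) P (τ / K) ≤
        ∫ ω, (1 + -(τ / K) * Y i ω ^ 2) + (τ / K) ^ 2 / 2 * Y i ω ^ 4 ∂P := by
      refine integral_mono_ae (integrable_of_forall_abs_le ?_ 1 ?_)
        (i12.add i2) (ae_of_all _ fun ω => ?_)
      · exact (((h.aemeasurable i).pow_const 2).neg.const_mul _).exp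
      · refine ae_of_all _ fun ω => ?_
        rw [abs_of_pos (Real.exp_pos _), Real.exp_le_one_iff]
        exact mul_nonpos_of_nonneg_of_nonpos (by positivity) (neg_nonpos.2 (sq_nonneg _))
      · have := exp_neg_le_quadratic (x := τ / K * Y i ω ^ 2) (by positivity)
        simp only
        rw [mul_neg]
        refine this.trans (le_of_eq ?_)
        ring
    rw [integral_add i12 i2, integral_add (integrable_const 1) i1,
      integral_const_mul, integral_const_mul, h.integral_sq] at h1
    simp only [integral_const, probReal_univ, smul_eq_mul, mul_one] at h1
    have h2 := mul_le_mul_of_nonneg_left (hK4 i) (show 0 ≤ (τ / K) ^ 2 / 2 by positivity)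
    have h3 := Real.add_one_le_exp (-(τ / K) * v + (τ / K) ^ 2 / 2 * K)
    linarith
  have h1 := measureReal_sum_ge_le_exp (Z := fun i ω => -Y i ω ^ 2) (a := -1) (b := 0)
    (h.indep.comp (fun _ y => -y ^ 2) fun _ => by fun_prop)
    (fun i => ((h.aemeasurable i).pow_const 2).neg)
    (fun i => by
      filter_upwards [h.abs_le_one i] with ω hω
      have : Y i ω ^ 2 ≤ 1 := (sq_le_one_iff_abs_le_one _).2 hω
      exact ⟨by linarith, neg_nonpos.2 (sq_nonneg _)⟩)
    (t := τ / K) (by positivity) hmgf (-x)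
  simp only [Finset.sum_neg_distrib, neg_le_neg_iff] at h1
  refine h1.trans (Real.exp_le_exp.2 ?_)
  have h2 := mul_le_mul_of_nonneg_left hx (show 0 ≤ τ / K by positivity)
  have e : (n : ℝ) * (-(τ / K) * v + (τ / K) ^ 2 / 2 * K) + τ / K * (n * (v - τ)) =
      -(n * (τ ^ 2 / (2 * K))) := by field_simp; ring
  linarith

end IsCenteredSample

/-! ### Numerical inequalities -/

/-- With `y = ε/2` the improved Hoeffding bound is `2y / ((1 - y)(1 + y)²)`, and the denominator `1
+ y (1 - y - y²)` exceeds 1 by enough to absorb `y²/4`. -/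
theorem exp_sub_one_div_add_le {ε : ℝ} (hε₀ : 0 < ε) (hε₁ : ε < 1) :
    (Real.exp (Real.log (2 / ε)) - 1) / (Real.cosh (2 * Real.log (2 / ε)) - 1) +
      Real.exp (-(2 * Real.log (4 / ε))) ≤ ε := by
  have h1 : Real.exp (Real.log (2 / ε)) = 2 / ε := Real.exp_log (by positivity)
  have h2 : Real.exp (-(2 * Real.log (4 / ε))) = (ε / 4) ^ 2 := by
    rw [mul_comm, ← neg_mul, Real.exp_mul, Real.exp_neg, Real.exp_log (by positivity), inv_div]
    norm_cast
  have h3 : Real.cosh (2 * Real.log (2 / ε)) = ((2 / ε) ^ 2 + (ε / 2) ^ 2) / 2 := by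
    have e : 2 * Real.log (2 / ε) = Real.log ((2 / ε) ^ 2) := by rw [Real.log_pow]; norm_num
    rw [e, Real.cosh_eq, Real.exp_neg, Real.exp_log (by positivity), ← inv_pow, inv_div]
  obtain ⟨y, rfl⟩ : ∃ y, ε = 2 * y := ⟨ε / 2, by ring⟩
  have hy0 : 0 < y := by linarith
  have hy1 : 0 < 1 / 2 - y := by linarith
  rw [h1, h2, h3]
  have e1 : ((2 / (2 * y)) ^ 2 + (2 * y / 2) ^ 2) / 2 - 1 = (1 - y ^ 2) ^ 2 / (2 * y ^ 2) := by
    field_simp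
    ring
  have e2 : (2 / (2 * y) - 1) = (1 - y) / y := by field_simp
  have h4 : 0 < 1 - y := by linarith
  have e3 : (1 - y) / y / ((1 - y ^ 2) ^ 2 / (2 * y ^ 2)) = 2 * y / ((1 - y) * (1 + y) ^ 2) := by
    have : (1 - y ^ 2) ^ 2 = (1 - y) ^ 2 * (1 + y) ^ 2 := by ring
    rw [this]
    field_simp
  rw [e1, e2, e3, ← le_sub_iff_add_le, div_le_iff₀ (by positivity)]
  have h5 : 0 ≤ y ^ 2 * (8 * (1 - y - y ^ 2) - (1 - y) * (1 + y) ^ 2) := by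
    refine mul_nonneg (sq_nonneg _) ?_
    nlinarith [mul_pos hy0 hy1, mul_pos (mul_pos hy0 hy0) hy1]
  nlinarith [h5]

theorem exp_neg_add_div_two_le {ε : ℝ} (hε₀ : 0 < ε) :
    2 * Real.exp (-((Real.log (2 / ε) + Real.log (4 / ε)) / 2)) + Real.exp (-Real.log (4 / ε))
      ≤ ε := by
  have h1 : Real.exp (-Real.log (4 / ε)) = ε / 4 := by
    rw [Real.exp_neg, Real.exp_log (by positivity), inv_div]
  have h2 : Real.exp (-((Real.log (2 / ε) + Real.log (4 / ε)) / 2)) ^ 2 = ε / 2 * (ε / 4) := by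
    rw [← Real.exp_nat_mul, Nat.cast_ofNat, mul_neg, mul_div_cancel₀ _ two_ne_zero, neg_add,
      Real.exp_add, Real.exp_neg, Real.exp_log (by positivity), inv_div, h1]
  have h3 : Real.exp (-((Real.log (2 / ε) + Real.log (4 / ε)) / 2)) ≤ 3 / 8 * ε :=
    le_of_sq_le_sq (by rw [h2]; nlinarith) (by positivity)
  linarith

/-- For small variance the fourth moment is bounded by `σ²`, so `τ ≥ s * σ` is needed; here `R` is
small because `σ` is. -/
theorem mul_le_sq_of_variance_le {s σ R τ : ℝ} (hs : 0 < s) (hσ : 7 / 6 * s ≤ σ)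
    (hσ8 : σ ^ 2 ≤ 1 / 8) (hR0 : 0 ≤ R) (hR : R ≤ σ * s + s ^ 2 / 6)
    (hτ : τ = 2 * σ * (7 / 6 * s) - (7 / 6 * s) ^ 2 - R ^ 2) :
    0 ≤ τ ∧ s ^ 2 * σ ^ 2 ≤ τ ^ 2 := by
  have h1 : R ≤ 8 / 7 * (σ * s) := by nlinarith
  have h2 : R ^ 2 ≤ 8 / 49 * s ^ 2 := by
    have := pow_le_pow_left₀ hR0 h1 2
    nlinarith [mul_le_mul_of_nonneg_right hσ8 (sq_nonneg s)]
  have h3 : s * σ ≤ τ := by nlinarith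
  have h4 : 0 ≤ s * σ := mul_nonneg hs.le (by linarith)
  exact ⟨h4.trans h3, by rw [← mul_pow]; exact pow_le_pow_left₀ h4 h3 2⟩

/-- For large variance `τ` may drop to `20/21 * s * σ`, because the fourth moment bound carries the
factor `1 - 3σ² ≤ 5/8`. -/
theorem mul_le_sq_of_le_variance {s σ R τ : ℝ} (hs : 0 < s) (hσ : 7 / 6 * s ≤ σ)
    (hσ8 : 1 / 8 ≤ σ ^ 2) (hR : R ^ 2 ≤ s ^ 2 / 4)
    (hτ : τ = 2 * σ * (7 / 6 * s) - (7 / 6 * s) ^ 2 - R ^ 2) :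
    0 ≤ τ ∧ s ^ 2 * (σ ^ 2 * (1 - 3 * σ ^ 2)) ≤ τ ^ 2 := by
  have h3 : 20 / 21 * (s * σ) ≤ τ := by nlinarith
  have h4 : 0 ≤ s * σ := mul_nonneg hs.le (by linarith)
  refine ⟨by linarith, ?_⟩
  have h5 := pow_le_pow_left₀ (by positivity) h3 2
  have h6 : 0 ≤ (s * σ) ^ 2 * (σ ^ 2 - 1 / 8) := mul_nonneg (sq_nonneg _) (by linarith)
  nlinarith [sq_nonneg (s * σ)]

/-- Here `ρ` is `ln (8 / ε ^ 2) / (2 * ln (4 / ε))`. -/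
theorem two_mul_mul_le_sq {s σ R τ ρ α : ℝ} (hs : 0 < s) (hσ0 : 0 < σ) (hρ0 : 3 / 4 ≤ ρ)
    (hρ1 : ρ ≤ 1) (hα0 : 0 < α) (hα : α ^ 2 = 2 * ρ - 1) (hR : R = α * s / 2)
    (hsR : 4 / 3 * s ^ 2 < R) (hRσ : R < σ * (√ρ * s) + ρ * s ^ 2 / 6)
    (hτ : τ = 2 * σ * (7 / 6 * s) - (7 / 6 * s) ^ 2 - R ^ 2) :
    1 / 8 ≤ σ ^ 2 ∧ 0 ≤ τ ∧ 2 * (s ^ 2 * (σ ^ 2 * (1 - 3 * σ ^ 2))) ≤ τ ^ 2 := by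
  have hq0 : 0 ≤ √ρ := Real.sqrt_nonneg _
  have hq2 : √ρ ^ 2 = ρ := Real.sq_sqrt (by linarith)
  set q := √ρ
  have h8 : 0 < 8 - ρ := by linarith
  have h1 : s < 3 / 8 * α := by
    rw [hR] at hsR
    nlinarith
  have h2 : α / 2 < σ * q + ρ * s / 6 := by
    rw [hR] at hRσ
    have : s * (α / 2) < s * (σ * q + ρ * s / 6) := by nlinarith
    exact lt_of_mul_lt_mul_left this hs.le
  have h3 : α * (8 - ρ) ≤ 16 * (σ * q) := by nlinarith
  have h4 : (2 * ρ - 1) * (8 - ρ) ^ 2 ≤ 256 * (σ ^ 2 * ρ) := by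
    have := pow_le_pow_left₀ (by positivity) h3 2
    rw [mul_pow, hα, mul_pow, mul_pow, hq2] at this
    linarith
  -- A linear minorant of the bound in `h4`, exact at `ρ = 1`; for `ρ ≥ 3/4` it is at least `33/256
  -- > 1/8`. So Bernstein's radius exceeds Hoeffding's only for large variance, where `1 - 3σ²` is
  -- small enough to gain the factor 2.
  have h5 : 49 / 256 - (1 - ρ) / 4 ≤ σ ^ 2 := by
    have : (49 / 256 - (1 - ρ) / 4) * (256 * ρ) ≤ (2 * ρ - 1) * (8 - ρ) ^ 2 := by
      nlinarith [mul_nonneg (sub_nonneg.2 hρ0) (sub_nonneg.2 hρ1),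
        mul_nonneg (mul_nonneg (sub_nonneg.2 hρ0) (sub_nonneg.2 hρ1)) (sub_nonneg.2 hρ0)]
    have h6 : (49 / 256 - (1 - ρ) / 4) * (256 * ρ) ≤ σ ^ 2 * (256 * ρ) := by linarith
    exact le_of_mul_le_mul_right h6 (by linarith)
  have h6 : q ≤ (1 + ρ) / 2 := by nlinarith [sq_nonneg (q - 1)]
  have h7 : s * (8 - ρ) ≤ 3 * (1 + ρ) * σ := by
    calc s * (8 - ρ) ≤ 3 / 8 * α * (8 - ρ) := by gcongr
      _ ≤ 6 * (σ * q) := by linarith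
      _ ≤ 6 * (σ * ((1 + ρ) / 2)) := by gcongr
      _ = _ := by ring
  have hτ' : τ = s * (7 / 3 * σ - s * (20 + 9 * ρ) / 18) := by
    rw [hτ, hR]
    linear_combination (-s ^ 2 / 4) * hα
  have h9 : (20 / 21 + 6 / 5 * (1 - ρ)) * σ ≤ 7 / 3 * σ - s * (20 + 9 * ρ) / 18 := by
    refine le_of_mul_le_mul_right ?_ h8
    have e1 := mul_le_mul_of_nonneg_right h7 (show 0 ≤ (20 + 9 * ρ) / 18 by positivity)
    have e2 : (20 / 21 + 6 / 5 * (1 - ρ)) * (8 - ρ) ≤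
        7 / 3 * (8 - ρ) - 3 * (1 + ρ) * ((20 + 9 * ρ) / 18) := by
      nlinarith [mul_nonneg (sub_nonneg.2 hρ0) (sub_nonneg.2 hρ1)]
    have e3 := mul_le_mul_of_nonneg_left e2 hσ0.le
    linarith
  have h10 : (20 / 21 + 6 / 5 * (1 - ρ)) * (s * σ) ≤ τ := by
    rw [hτ']
    have := mul_le_mul_of_nonneg_left h9 hs.le
    linarith
  have hc : 0 ≤ 20 / 21 + 6 / 5 * (1 - ρ) := by linarith
  refine ⟨by linarith, le_trans (by positivity) h10, ?_⟩
  have h11 := pow_le_pow_left₀ (by positivity) h10 2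
  have h12 : 2 * (1 - 3 * σ ^ 2) ≤ (20 / 21 + 6 / 5 * (1 - ρ)) ^ 2 := by nlinarith
  have h13 := mul_le_mul_of_nonneg_left h12 (sq_nonneg (s * σ))
  calc 2 * (s ^ 2 * (σ ^ 2 * (1 - 3 * σ ^ 2))) = (s * σ) ^ 2 * (2 * (1 - 3 * σ ^ 2)) := by ring
    _ ≤ _ := h13
    _ = ((20 / 21 + 6 / 5 * (1 - ρ)) * (s * σ)) ^ 2 := by ring
    _ ≤ _ := h11

/-! ### The sample variance -/

theorem sampleVariance_nonneg {n : ℕ} (hn : 2 ≤ n) (y : Fin n → ℝ) : 0 ≤ sampleVariance y := by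
  have : (2 : ℝ) ≤ n := by exact_mod_cast hn
  exact mul_nonneg (one_div_nonneg.2 (by linarith)) (Finset.sum_nonneg fun _ _ => sq_nonneg _)

theorem sum_sq_eq {n : ℕ} (hn : 2 ≤ n) (y : Fin n → ℝ) :
    ∑ i, y i ^ 2 = (n - 1) * sampleVariance y + n * sampleMean y ^ 2 := by
  have h2 : (2 : ℝ) ≤ n := by exact_mod_cast hn
  have h1 : (n : ℝ) - 1 ≠ 0 := by linarith
  have hsum : ∑ i, y i = n * sampleMean y := by
    unfold sampleMean
    field_simp
  unfold sampleVariance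
  rw [← mul_assoc, mul_one_div_cancel h1, one_mul]
  simp only [sub_sq, Finset.sum_add_distrib, Finset.sum_sub_distrib, Finset.sum_const,
    Finset.card_univ, Fintype.card_fin, nsmul_eq_mul]
  rw [← Finset.sum_mul, ← Finset.mul_sum, hsum]
  ring

/-- A sample mean beyond the empirical Bernstein radius, but within the Bernstein radius, forces
the sample standard deviation to be small. -/
theorem sqrt_sampleVariance_lt {n : ℕ} (hn : 2 ≤ n) {y : Fin n → ℝ} {σ u w s : ℝ} (hσ : 0 ≤ σ)
    (hu : 0 < u) (hwu : w ≤ u) (hs : s = √(2 * u / n))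
    (h1 : √(2 / n * sampleVariance y * u) + 8 / (3 * ((n : ℝ) - 1)) * u < |sampleMean y|)
    (h2 : |sampleMean y| ≤ σ * √(2 * w / n) + w / (3 * n)) :
    √(sampleVariance y) < σ - 7 / 6 * s := by
  have hn2 : (2 : ℝ) ≤ n := by exact_mod_cast hn
  have hn0 : (0 : ℝ) < n := by linarith
  have hs0 : 0 < s := hs ▸ Real.sqrt_pos.2 (by positivity)
  have hss : s ^ 2 = 2 * u / n := by rw [hs, Real.sq_sqrt (by positivity)]
  have e1 : √(2 / n * sampleVariance y * u) = √(sampleVariance y) * s := by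
    rw [hs, ← Real.sqrt_mul (sampleVariance_nonneg hn y)]
    congr 1
    ring
  have e2 : 4 / 3 * s ^ 2 ≤ 8 / (3 * ((n : ℝ) - 1)) * u := by
    calc 4 / 3 * s ^ 2 = 8 / (3 * n) * u := by rw [hss]; field_simp; norm_num
      _ ≤ 8 / (3 * ((n : ℝ) - 1)) * u := by
        gcongr
        · linarith
        · linarith
  have e3 : σ * √(2 * w / n) + w / (3 * n) ≤ σ * s + s ^ 2 / 6 := by
    have : s ^ 2 / 6 = u / (3 * n) := by rw [hss]; field_simp; norm_num
    rw [this, hs]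
    gcongr
  rw [e1] at h1
  -- `7/6 = 4/3 - 1/6`: the linear term of the empirical radius minus that of the Bernstein radius,
  -- in units of `s²`.
  have : √(sampleVariance y) * s < (σ - 7 / 6 * s) * s := by nlinarith
  exact lt_of_mul_lt_mul_right this hs0.le

/-! ### Simultaneous validity of the Hoeffding and the empirical Bernstein bounds -/

namespace IsCenteredSample

variable {n : ℕ} {Y : Fin n → Ω → ℝ} {c v : ℝ}

/-- On the event, `√Vₙ < σ - 7/6 s` and `|Sₙ| ≤ R`, so `∑ Yᵢ² = (n-1) Vₙ + n Sₙ²` is at most `n (σ²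
- τ)`. By `hk`, the tail exponent `nτ² / (2K)` is at least `k * u`. -/
theorem measureReal_empirical_bernstein_le (h : IsCenteredSample Y P c v) (hn : 2 ≤ n)
    {σ u w s R τ K : ℝ} (hσ : 0 < σ) (hv : v = σ ^ 2) (hu : 0 < u) (hwu : w ≤ u)
    (hs : s = √(2 * u / n)) (hK : 0 < K) (hK4 : ∀ i, ∫ ω, Y i ω ^ 4 ∂P ≤ K)
    (hτ : τ = 2 * σ * (7 / 6 * s) - (7 / 6 * s) ^ 2 - R ^ 2) (hτ0 : 0 ≤ τ) {k : ℝ}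
    (hk : k * (s ^ 2 * K) ≤ τ ^ 2) :
    P.real {ω | √(2 / n * sampleVariance (fun i => Y i ω) * u) + 8 / (3 * ((n : ℝ) - 1)) * u <
        |sampleMean fun i => Y i ω| ∧
      |sampleMean fun i => Y i ω| ≤ σ * √(2 * w / n) + w / (3 * n) ∧
      |sampleMean fun i => Y i ω| ≤ R} ≤ Real.exp (-(k * u)) := by
  have hn2 : (2 : ℝ) ≤ n := by exact_mod_cast hn
  have hn0 : (0 : ℝ) < n := by linarith
  have hss : s ^ 2 = 2 * u / n := by rw [hs, Real.sq_sqrt (by positivity)]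
  refine le_trans (measureReal_mono fun ω hω => ?_)
    ((h.measureReal_sum_sq_le hK hK4 hτ0 le_rfl).trans (Real.exp_le_exp.2 ?_))
  · obtain ⟨h1, h2, h3⟩ := hω
    have h4 := sqrt_sampleVariance_lt hn hσ.le hu hwu hs h1 h2
    have hV := sampleVariance_nonneg hn fun i => Y i ω
    have h5 : sampleVariance (fun i => Y i ω) ≤ (σ - 7 / 6 * s) ^ 2 := by
      rw [← Real.sq_sqrt hV]
      exact pow_le_pow_left₀ (Real.sqrt_nonneg _) h4.le 2
    have h6 : sampleMean (fun i => Y i ω) ^ 2 ≤ R ^ 2 := by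
      rw [← sq_abs]
      exact pow_le_pow_left₀ (abs_nonneg _) h3 2
    simp only [mem_ofPred_eq]
    rw [sum_sq_eq hn, hv, hτ]
    nlinarith [mul_le_mul_of_nonneg_left h5 hn0.le, mul_le_mul_of_nonneg_left h6 hn0.le]
  · rw [neg_le_neg_iff]
    have e : k * u = n * (k * (s ^ 2 * K) / (2 * K)) := by
      rw [hss]
      field_simp
    rw [e]
    gcongr

theorem measureReal_eq_zero_of_variance_eq_zero (h : IsCenteredSample Y P c v) (hv : v = 0)
    {r₁ : ℝ} {r₂ : Ω → ℝ} (hr₁ : 0 ≤ r₁) (hr₂ : ∀ ω, 0 ≤ r₂ ω) :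
    P.real {ω | ¬ (|sampleMean fun i => Y i ω| ≤ r₁ ∧ |sampleMean fun i => Y i ω| ≤ r₂ ω)} = 0 := by
  have h0 : ∀ i, ∀ᵐ ω ∂P, Y i ω = 0 := fun i => by
    have h1 := h.integral_sq i
    rw [hv, integral_eq_zero_iff_of_nonneg (fun _ => sq_nonneg _) (h.integrable_pow i 2)] at h1
    filter_upwards [h1] with ω hω
    simpa using hω
  rw [measureReal_def]
  have : P {ω | ¬ (|sampleMean fun i => Y i ω| ≤ r₁ ∧ |sampleMean fun i => Y i ω| ≤ r₂ ω)} = 0 := by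
    rw [← ae_iff]
    filter_upwards [ae_all_iff.2 h0] with ω hω
    simp [sampleMean, hω, hr₁, hr₂ ω]
  rw [this, ENNReal.toReal_zero]

theorem measureReal_simultaneous_le_of_bernstein_le (h : IsCenteredSample Y P c v) (hn : 2 ≤ n)
    {σ l u w s r₁ : ℝ} (hσ : 0 < σ) (hv : v = σ ^ 2) (hu : 0 < u) (hlu : l ≤ u) (hw0 : 0 < w)
    (hwu : w ≤ u) (hs : s = √(2 * u / n)) (hr₁ : r₁ = √(l / (2 * n)))
    (hB : σ * √(2 * w / n) + w / (3 * n) ≤ r₁) :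
    P.real {ω | √(2 / n * sampleVariance (fun i => Y i ω) * u) + 8 / (3 * ((n : ℝ) - 1)) * u <
        |sampleMean fun i => Y i ω| ∧
      |sampleMean fun i => Y i ω| ≤ σ * √(2 * w / n) + w / (3 * n)} ≤ Real.exp (-u) := by
  have hn2 : (2 : ℝ) ≤ n := by exact_mod_cast hn
  have hn0 : (0 : ℝ) < n := by linarith
  have hs0 : 0 < s := hs ▸ Real.sqrt_pos.2 (by positivity)
  have hss : s ^ 2 = 2 * u / n := by rw [hs, Real.sq_sqrt (by positivity)]
  -- If `σ < 7/6 s`, the sample standard deviation would be negative, so the event is empty.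
  rcases lt_or_ge σ (7 / 6 * s) with hd | hd
  · refine le_trans (le_of_eq ?_) (Real.exp_pos _).le
    rw [← measureReal_empty (μ := P)]
    congr 1
    refine eq_empty_of_forall_notMem fun ω ⟨h1, h2⟩ => ?_
    have := sqrt_sampleVariance_lt hn hσ.le hu hwu hs h1 h2
    linarith [Real.sqrt_nonneg (sampleVariance fun i => Y i ω)]
  set R := σ * √(2 * w / n) + w / (3 * n) with hR
  have hR0 : 0 ≤ R := by positivity
  have hRs : R ≤ σ * s + s ^ 2 / 6 := by
    have : s ^ 2 / 6 = u / (3 * n) := by rw [hss]; field_simp; norm_num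
    rw [this, hs, hR]
    gcongr
  have hR2 : R ^ 2 ≤ s ^ 2 / 4 := by
    -- For negative `l` the root `r₁` would be 0 by convention, contradicting `0 < R ≤ r₁`.
    have h0 : 0 ≤ l / (2 * n) := by
      by_contra! hneg
      rw [Real.sqrt_eq_zero_of_nonpos hneg.le] at hr₁
      have : 0 < R := by positivity
      linarith
    calc R ^ 2 ≤ r₁ ^ 2 := pow_le_pow_left₀ hR0 hB 2
      _ = l / (2 * n) := by rw [hr₁, Real.sq_sqrt h0]
      _ ≤ u / (2 * n) := by gcongr
      _ = s ^ 2 / 4 := by rw [hss]; field_simp; norm_num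
  have i₀ : Fin n := ⟨0, by omega⟩
  have hv4 := h.variance_le_quarter i₀
  rw [show -u = -(1 * u) by ring]
  rcases le_total (σ ^ 2) (1 / 8) with h8 | h8
  · obtain ⟨hτ0, hτ⟩ := mul_le_sq_of_variance_le hs0 hd h8 hR0 hRs rfl
    refine le_trans (measureReal_mono fun ω hω => ?_)
      (h.measureReal_empirical_bernstein_le hn hσ hv hu hwu hs (K := σ ^ 2) (by positivity)
        (fun i => hv ▸ h.integral_pow_four_le_variance i) rfl hτ0 (by rwa [one_mul]))
    exact ⟨hω.1, hω.2, hω.2⟩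
  · obtain ⟨hτ0, hτ⟩ := mul_le_sq_of_le_variance hs0 hd h8 hR2 rfl
    refine le_trans (measureReal_mono fun ω hω => ?_)
      (h.measureReal_empirical_bernstein_le hn hσ hv hu hwu hs
        (K := σ ^ 2 * (1 - 3 * σ ^ 2)) (mul_pos (by positivity) (by linarith))
        (fun i => hv ▸ h.integral_pow_four_le i (hv ▸ h8)) rfl hτ0 (by rwa [one_mul]))
    exact ⟨hω.1, hω.2, hω.2⟩

theorem measureReal_simultaneous_le_of_lt_bernstein (h : IsCenteredSample Y P c v) (hn : 2 ≤ n)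
    {σ l u w r₁ : ℝ} (hσ : 0 < σ) (hv : v = σ ^ 2) (hu : 0 < u) (hul : u ≤ 2 * l)
    (hlu : l ≤ u) (hw : w = (l + u) / 2) (hr₁ : r₁ = √(l / (2 * n)))
    (hB : r₁ < σ * √(2 * w / n) + w / (3 * n)) :
    P.real {ω | √(2 / n * sampleVariance (fun i => Y i ω) * u) + 8 / (3 * ((n : ℝ) - 1)) * u <
        |sampleMean fun i => Y i ω| ∧ |sampleMean fun i => Y i ω| ≤ r₁} ≤
      Real.exp (-(2 * u)) := by
  have hn2 : (2 : ℝ) ≤ n := by exact_mod_cast hn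
  have hn0 : (0 : ℝ) < n := by linarith
  have hl : 0 < l := by linarith
  set s := √(2 * u / n) with hs
  have hs0 : 0 < s := Real.sqrt_pos.2 (by positivity)
  have hss : s ^ 2 = 2 * u / n := by rw [hs, Real.sq_sqrt (by positivity)]
  -- The linear term of the empirical radius is at least `4/3 s²`; if that reaches `r₁`, the event
  -- is empty.
  rcases le_or_gt r₁ (4 / 3 * s ^ 2) with hsmall | hsR
  · refine le_trans (le_of_eq ?_) (Real.exp_pos _).le
    rw [← measureReal_empty (μ := P)]
    congr 1
    refine eq_empty_of_forall_notMem fun ω ⟨h1, h2⟩ => ?_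
    have e2 : 4 / 3 * s ^ 2 ≤ 8 / (3 * ((n : ℝ) - 1)) * u := by
      calc 4 / 3 * s ^ 2 = 8 / (3 * n) * u := by rw [hss]; field_simp; norm_num
        _ ≤ 8 / (3 * ((n : ℝ) - 1)) * u := by
          gcongr
          · linarith
          · linarith
    linarith [Real.sqrt_nonneg (2 / n * sampleVariance (fun i => Y i ω) * u)]
  have hα : √(l / u) ^ 2 = 2 * (w / u) - 1 := by
    rw [Real.sq_sqrt (by positivity), hw]
    field_simp
    ring
  have hr : r₁ = √(l / u) * s / 2 := by
    have h4 : (2 : ℝ) = √(2 ^ 2) := by rw [Real.sqrt_sq (by norm_num)]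
    rw [hr₁, hs, ← Real.sqrt_mul (by positivity), h4, ← Real.sqrt_div (by positivity), ← h4]
    congr 1
    field_simp
  have hB' : r₁ < σ * (√(w / u) * s) + w / u * s ^ 2 / 6 := by
    have e1 : √(w / u) * s = √(2 * w / n) := by
      rw [hs, ← Real.sqrt_mul (div_nonneg (by linarith) hu.le)]
      congr 1
      field_simp
    have e2 : w / u * s ^ 2 / 6 = w / (3 * n) := by rw [hss]; field_simp; ring
    rwa [e1, e2]
  obtain ⟨h8, hτ0, hτ⟩ := two_mul_mul_le_sq hs0 hσ (ρ := w / u)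
    (by rw [le_div_iff₀ hu]; linarith) (by rw [div_le_one hu]; linarith)
    (Real.sqrt_pos.2 (div_pos hl hu)) hα hr hsR hB' rfl
  have i₀ : Fin n := ⟨0, by omega⟩
  have hv4 := h.variance_le_quarter i₀
  refine le_trans (measureReal_mono fun ω hω => ?_)
    (h.measureReal_empirical_bernstein_le hn hσ hv hu (w := w) (by linarith) hs
      (K := σ ^ 2 * (1 - 3 * σ ^ 2)) (mul_pos (by positivity) (by linarith))
      (fun i => hv ▸ h.integral_pow_four_le i (hv ▸ h8)) rfl hτ0 hτ)
  exact ⟨hω.1, hω.2.trans hB.le, hω.2⟩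

/-- With probability at least `1 - ε`, the sample mean satisfies both Hoeffding's bound and the
empirical Bernstein bound. -/
theorem measureReal_simultaneous_le (h : IsCenteredSample Y P c v) (hn : 2 ≤ n) {ε : ℝ}
    (hε₀ : 0 < ε) (hε₁ : ε < 1) :
    P.real {ω | ¬ (|sampleMean fun i => Y i ω| ≤ √(Real.log (2 / ε) / (2 * n)) ∧
      |sampleMean fun i => Y i ω| ≤
        √(2 / n * sampleVariance (fun i => Y i ω) * Real.log (4 / ε)) +
          8 / (3 * ((n : ℝ) - 1)) * Real.log (4 / ε))} ≤ ε := by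
  have hn2 : (2 : ℝ) ≤ n := by exact_mod_cast hn
  have hlog2 := Real.log_pos one_lt_two
  have hul : Real.log (4 / ε) = Real.log (2 / ε) + Real.log 2 := by
    rw [← Real.log_mul (by positivity) (by positivity)]
    congr 1
    ring
  have hl2 : Real.log 2 ≤ Real.log (2 / ε) :=
    Real.log_le_log two_pos (by rw [le_div_iff₀ hε₀]; linarith)
  have hbern := exp_neg_add_div_two_le hε₀
  have hhoef := exp_sub_one_div_add_le hε₀ hε₁
  set l := Real.log (2 / ε)
  set u := Real.log (4 / ε)
  have hl : 0 < l := by linarith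
  have hu : 0 < u := by linarith
  have i₀ : Fin n := ⟨0, by omega⟩
  -- Zero variance is separate because the tail bounds divide by `σ` and by the fourth moment bound.
  rcases (h.variance_nonneg i₀).eq_or_lt with hv0 | hv0
  · rw [h.measureReal_eq_zero_of_variance_eq_zero hv0.symm (Real.sqrt_nonneg _)]
    · exact hε₀.le
    · intro ω
      have : 0 < (n : ℝ) - 1 := by linarith
      positivity
  have hσ : 0 < √v := Real.sqrt_pos.2 hv0
  have hv : v = √v ^ 2 := (Real.sq_sqrt hv0.le).symm
  rcases le_or_gt (√v * √(2 * ((l + u) / 2) / n) + (l + u) / 2 / (3 * n)) √(l / (2 * n))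
    with hB | hB
  · refine le_trans ?_ ((add_le_add (h.measureReal_bernstein_le (by omega) hσ hv
      (w := (l + u) / 2) (by linarith)) (h.measureReal_simultaneous_le_of_bernstein_le hn hσ hv hu
      (by linarith) (by linarith) (by linarith) rfl rfl hB)).trans hbern)
    refine le_trans (measureReal_mono fun ω hω => ?_) (measureReal_union_le _ _)
    rcases lt_or_ge (√v * √(2 * ((l + u) / 2) / n) + (l + u) / 2 / (3 * n))
      |sampleMean fun i => Y i ω| with hT | hT
    · exact Or.inl hT
    · refine Or.inr ⟨?_, hT⟩
      by_contra! h2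
      exact hω ⟨hT.trans hB, h2⟩
  · refine le_trans ?_ ((add_le_add (h.measureReal_hoeffding_le (by omega) hl)
      (h.measureReal_simultaneous_le_of_lt_bernstein hn hσ hv hu (by linarith) (by linarith) rfl
        rfl hB)).trans hhoef)
    refine le_trans (measureReal_mono fun ω hω => ?_) (measureReal_union_le _ _)
    rcases lt_or_ge √(l / (2 * n)) |sampleMean fun i => Y i ω| with hT | hT
    · exact Or.inl hT
    · refine Or.inr ⟨?_, hT⟩
      by_contra! h2
      exact hω ⟨hT, h2⟩

end IsCenteredSample

end Concentration

/-! ### Affine changes of the data -/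

theorem sampleMean_sub_div {n : ℕ} (hn : 1 ≤ n) (x : Fin n → ℝ) (m d : ℝ) :
    sampleMean (fun i => (x i - m) / d) = (sampleMean x - m) / d := by
  have : (n : ℝ) ≠ 0 := by positivity
  simp only [sampleMean, ← Finset.sum_div, Finset.sum_sub_distrib, Finset.sum_const,
    Finset.card_univ, Fintype.card_fin, nsmul_eq_mul]
  field_simp

theorem sampleVariance_sub_div {n : ℕ} (hn : 1 ≤ n) (x : Fin n → ℝ) (m d : ℝ) :
    sampleVariance (fun i => (x i - m) / d) = sampleVariance x / d ^ 2 := by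
  have h : ∀ i, ((x i - m) / d - (sampleMean x - m) / d) ^ 2 = (x i - sampleMean x) ^ 2 / d ^ 2 :=
    fun i => by rw [← sub_div, sub_sub_sub_cancel_right, div_pow]
  simp only [sampleVariance, sampleMean_sub_div hn, h, ← Finset.sum_div, mul_div_assoc]

namespace Model

variable {H : Type*} [NormedAddCommGroup H] [InnerProductSpace ℂ H] [CompleteSpace H]
  {T₁ T₂ T₃ : Type*} (M : Model H T₁ T₂ T₃)

theorem law_compl_Icc (φ : ℝ) (η : T₁ × T₂ × T₃) : M.law φ η (Icc M.a M.b)ᶜ = 0 := by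
  rw [law, outcomeLaw, Measure.ofMeasurable_apply _ measurableSet_Icc.compl,
    POVM.effect_compl_Icc]
  simp [opTrace]

variable {M} {φ : ℝ} {η : T₁ × T₂ × T₃} {Ω : Type*} [MeasurableSpace Ω] {P : Measure Ω}

theorem ae_mem_Icc_of_hasLaw {X : Ω → ℝ} (hX : HasLaw X (M.law φ η) P) :
    ∀ᵐ ω ∂P, X ω ∈ Icc M.a M.b :=
  (hX.ae_iff measurableSet_Icc.mem).2 (M.law_compl_Icc φ η)

theorem isCenteredSample [IsProbabilityMeasure P] (hab : M.a < M.b) {n : ℕ} {X : Fin n → Ω → ℝ}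
    (hX : iIndepFun X P) (hlaw : ∀ i, HasLaw (X i) (M.law φ η) P) :
    IsCenteredSample (fun i ω => (X i ω - M.f η φ) / (M.b - M.a)) P
      ((M.a - M.f η φ) / (M.b - M.a))
      (∫ x, ((x - M.f η φ) / (M.b - M.a)) ^ 2 ∂(M.law φ η)) where
  indep := hX.comp (fun _ x => (x - M.f η φ) / (M.b - M.a)) fun _ => by fun_prop
  aemeasurable i := ((hlaw i).aemeasurable.sub_const _).div_const _
  mem_Icc i := by
    have hd : 0 < M.b - M.a := sub_pos.2 hab
    filter_upwards [ae_mem_Icc_of_hasLaw (hlaw i)] with ω hω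
    constructor
    · have := hω.1
      gcongr
    · rw [div_add_one hd.ne']
      have := hω.2
      gcongr
      linarith
  integral_eq_zero i := by
    have hint : Integrable (X i) P :=
      integrable_of_forall_abs_le (hlaw i).aemeasurable (max |M.a| |M.b|) <| by
        filter_upwards [ae_mem_Icc_of_hasLaw (hlaw i)] with ω hω using
          abs_le_max_abs_abs hω.1 hω.2
    rw [integral_div, integral_sub hint (integrable_const _), (hlaw i).integral_eq]
    simp [f]
  integral_sq i := (hlaw i).integral_comp
    (f := fun x => ((x - M.f η φ) / (M.b - M.a)) ^ 2) (by fun_prop)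

/-- The Hoeffding deviation `√((2/n) V_max ln(2/ε))`. -/
noncomputable def hoeffdingRadius (M : Model H T₁ T₂ T₃) (n : ℕ) (ε : ℝ) : ℝ :=
  √(2 / (n : ℝ) * M.Vmax * Real.log (2 / ε))

theorem delta₁_eq {n : ℕ} (x : Fin n → ℝ) {ε : ℝ} (hε₀ : 0 < ε) (hε₁ : ε < 1) :
    M.delta₁ x ε η = 1 / |M.df η (M.phiLS x η)| * M.hoeffdingRadius n ε +
      M.L η / 2 * M.hoeffdingRadius n ε ^ 2 := by
  have hlog : 0 ≤ Real.log (2 / ε) := Real.log_nonneg (by rw [le_div_iff₀ hε₀]; linarith)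
  have hV : 0 ≤ M.Vmax := div_nonneg (sq_nonneg _) (by norm_num)
  rw [delta₁, hoeffdingRadius, Real.sq_sqrt (by positivity)]
  ring

theorem hoeffdingRadius_eq (hab : M.a < M.b) {n : ℕ} {ε : ℝ} :
    M.hoeffdingRadius n ε = (M.b - M.a) * √(Real.log (2 / ε) / (2 * n)) := by
  have hd : 0 < M.b - M.a := sub_pos.2 hab
  nth_rw 1 [← Real.sqrt_sq hd.le]
  rw [hoeffdingRadius, Vmax, ← Real.sqrt_mul (sq_nonneg _)]
  congr 1
  ring

theorem bernsteinRadius_eq (hab : M.a < M.b) {n : ℕ} (hn : 1 ≤ n) (x : Fin n → ℝ) (ε m : ℝ) :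
    M.bernsteinRadius x ε = (M.b - M.a) *
      (√(2 / n * sampleVariance (fun i => (x i - m) / (M.b - M.a)) * Real.log (4 / ε)) +
        8 / (3 * ((n : ℝ) - 1)) * Real.log (4 / ε)) := by
  have hd : 0 < M.b - M.a := sub_pos.2 hab
  have h : √(2 / n * sampleVariance x * Real.log (4 / ε)) = (M.b - M.a) *
      √(2 / n * sampleVariance (fun i => (x i - m) / (M.b - M.a)) * Real.log (4 / ε)) := by
    have e : 2 / n * sampleVariance x * Real.log (4 / ε) = (M.b - M.a) ^ 2 *
        (2 / n * (sampleVariance x / (M.b - M.a) ^ 2) * Real.log (4 / ε)) := by field_simp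
    rw [sampleVariance_sub_div hn, e, Real.sqrt_mul (sq_nonneg _), Real.sqrt_sq hd.le]
  rw [bernsteinRadius, h]
  ring

theorem Admissible.abs_phiLS_sub_le_delta (h : M.Admissible η) (hφ : φ ∈ M.Phi) {n : ℕ}
    {x : Fin n → ℝ} {ε : ℝ} (hε₀ : 0 < ε) (hε₁ : ε < 1)
    (h1 : |sampleMean x - M.f η φ| ≤ M.hoeffdingRadius n ε)
    (h2 : n ≠ 1 → |sampleMean x - M.f η φ| ≤ M.bernsteinRadius x ε) :
    |M.phiLS x η - φ| ≤ M.delta x ε η := by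
  have h3 := (h.abs_phiLS_sub_le hφ h1).trans_eq (delta₁_eq x hε₀ hε₁).symm
  rw [delta]
  split_ifs with hn
  · exact h3
  · exact le_min h3 (h.abs_phiLS_sub_le hφ (h2 hn))

theorem measureReal_deviation_le [IsProbabilityMeasure P] {n : ℕ} (hn : 1 ≤ n)
    {X : Fin n → Ω → ℝ} (hX : iIndepFun X P) (hlaw : ∀ i, HasLaw (X i) (M.law φ η) P) {ε : ℝ}
    (hε₀ : 0 < ε) (hε₁ : ε < 1) :
    P.real {ω | ¬ (|sampleMean (fun i => X i ω) - M.f η φ| ≤ M.hoeffdingRadius n ε ∧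
      (n ≠ 1 → |sampleMean (fun i => X i ω) - M.f η φ| ≤
        M.bernsteinRadius (fun i => X i ω) ε))} ≤ ε := by
  have hlog4 : 0 ≤ Real.log (4 / ε) := Real.log_nonneg (by rw [le_div_iff₀ hε₀]; linarith)
  have hlog2 : 0 < Real.log (2 / ε) := Real.log_pos (by rw [lt_div_iff₀ hε₀]; linarith)
  have i₀ : Fin n := ⟨0, hn⟩
  rcases lt_or_ge M.a M.b with hab | hab
  · have hd : 0 < M.b - M.a := sub_pos.2 hab
    have hY := isCenteredSample hab hX hlaw
    have hT : ∀ ω, |sampleMean (fun i => X i ω) - M.f η φ| = (M.b - M.a) *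
        |sampleMean fun i => (X i ω - M.f η φ) / (M.b - M.a)| := fun ω => by
      rw [sampleMean_sub_div hn (fun i => X i ω), abs_div, abs_of_pos hd, mul_div_cancel₀ _ hd.ne']
    rcases hn.eq_or_lt with hn1 | hn2
    -- For a single outcome only Hoeffding's bound is required.
    · have h1 := hY.measureReal_hoeffding_le hn hlog2
      have h2 := exp_sub_one_div_add_le hε₀ hε₁
      have h3 := Real.exp_pos (-(2 * Real.log (4 / ε)))
      refine le_trans (measureReal_mono fun ω hω => ?_) (h1.trans (by linarith))
      by_contra hlt
      refine hω ⟨?_, fun h => absurd hn1.symm h⟩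
      rw [hT, hoeffdingRadius_eq hab]
      exact mul_le_mul_of_nonneg_left (not_lt.1 hlt) hd.le
    · refine le_trans (measureReal_mono fun ω hω => ?_)
        (hY.measureReal_simultaneous_le hn2 hε₀ hε₁)
      refine fun h => hω ⟨?_, fun _ => ?_⟩
      · rw [hT, hoeffdingRadius_eq hab]
        exact mul_le_mul_of_nonneg_left h.1 hd.le
      · rw [hT, bernsteinRadius_eq hab hn _ _ (M.f η φ)]
        exact mul_le_mul_of_nonneg_left h.2 hd.le
  -- Outcomes exist, so `b ≤ a` forces `a = b`. Rescaling would divide by zero, but the data are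
  -- almost surely constant.
  · have hmem := ae_all_iff.2 fun i => ae_mem_Icc_of_hasLaw (hlaw i)
    have hab' : M.a = M.b := by
      obtain ⟨ω, hω⟩ := hmem.exists
      exact le_antisymm ((hω i₀).1.trans (hω i₀).2) hab
    have hXa : ∀ i, ∀ᵐ ω ∂P, X i ω = M.a := fun i => by
      filter_upwards [hmem] with ω hω
      exact le_antisymm (hab' ▸ (hω i).2) (hω i).1
    have hf : M.f η φ = M.a := by
      rw [f, ← (hlaw i₀).integral_eq, integral_congr_ae (hXa i₀)]
      simp
    have h0 : P {ω | ¬ (|sampleMean (fun i => X i ω) - M.f η φ| ≤ M.hoeffdingRadius n ε ∧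
      (n ≠ 1 → |sampleMean (fun i => X i ω) - M.f η φ| ≤
        M.bernsteinRadius (fun i => X i ω) ε))} = 0 := by
      rw [← ae_iff]
      filter_upwards [ae_all_iff.2 hXa] with ω hω
      have hn0 : (n : ℝ) ≠ 0 := by positivity
      have hmean : sampleMean (fun i => X i ω) - M.f η φ = 0 := by
        simp [sampleMean, hω, hf, hn0]
      rw [hmean, abs_zero]
      refine ⟨Real.sqrt_nonneg _, fun _ => ?_⟩
      simp only [bernsteinRadius, hab', sub_self, mul_zero, zero_div, zero_mul, add_zero]
      exact Real.sqrt_nonneg _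
    rw [measureReal_def, h0, ENNReal.toReal_zero]
    exact hε₀.le

theorem coe_abs_phiLS_sub_le_deltaTilde {E : Set (T₁ × T₂ × T₃)} (hη : η ∈ E) {n : ℕ}
    {x : Fin n → ℝ} {ε : ℝ} (η' : T₁ × T₂ × T₃) (h : |M.phiLS x η - φ| ≤ M.delta x ε η) :
    ((|M.phiLS x η' - φ| : ℝ) : EReal) ≤ M.deltaTilde E x ε η' := by
  refine le_trans ?_ (le_iSup₂_of_le η hη le_rfl)
  refine EReal.coe_le_coe_iff.2 ((abs_sub_le _ (M.phiLS x η) _).trans ?_)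
  linarith

end Model

/-- Measurability of the event is not needed: the complement of a measurable hull of the failure set
is a measurable subset with the right probability. -/
theorem HoldsWithProbAtLeast.of_measureReal_compl_le {Ω : Type*} [MeasurableSpace Ω]
    {P : Measure Ω} [IsProbabilityMeasure P] {ε : ℝ} {A : Set Ω} (h : P.real Aᶜ ≤ ε) :
    HoldsWithProbAtLeast P (1 - ε) A := by
  refine ⟨(toMeasurable P Aᶜ)ᶜ, compl_subset_comm.1 (subset_toMeasurable P Aᶜ),
    (measurableSet_toMeasurable P Aᶜ).compl, ?_⟩
  rw [← ofReal_measureReal, probReal_compl_eq_one_sub (measurableSet_toMeasurable P Aᶜ),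
    measureReal_def, measure_toMeasurable, ← measureReal_def]
  exact ENNReal.ofReal_le_ofReal (by linarith)

end Metrology

theorem lemma2 {H : Type*} [NormedAddCommGroup H] [InnerProductSpace ℂ H] [CompleteSpace H]
    {T₁ T₂ T₃ : Type*} (M : Metrology.Model H T₁ T₂ T₃)
    -- the known region of noise parameters
    (E : Set (T₁ × T₂ × T₃)) (hE : ∀ η ∈ E, M.Admissible η)
    (n : ℕ) (hn : 1 ≤ n) (ε : ℝ) (hε₀ : 0 < ε) (hε₁ : ε < 1)
    -- the true parameters
    (φ : ℝ) (hφ : φ ∈ M.Phi) (η : T₁ × T₂ × T₃) (hη : η ∈ E)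
    -- the user-specified noise parameters
    (η' : T₁ × T₂ × T₃)
    -- the data: `n` independent outcomes of the experiment with the true parameters
    {Ω : Type*} [MeasurableSpace Ω] (P : Measure Ω) [IsProbabilityMeasure P]
    (X : Fin n → Ω → ℝ) (hX_indep : iIndepFun X P) (hX_law : ∀ i, HasLaw (X i) (M.law φ η) P) :
    Metrology.HoldsWithProbAtLeast P (1 - ε)
      {ω | ((|M.phiLS (fun i => X i ω) η' - φ| : ℝ) : EReal)
        ≤ M.deltaTilde E (fun i => X i ω) ε η'} := by
  refine Metrology.HoldsWithProbAtLeast.of_measureReal_compl_le (le_trans (measureReal_mono ?_)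
    (Metrology.Model.measureReal_deviation_le hn hX_indep hX_law hε₀ hε₁))
  refine compl_subset_compl.2 fun ω hω => ?_
  exact Metrology.Model.coe_abs_phiLS_sub_le_deltaTilde hη η'
    ((hE η hη).abs_phiLS_sub_le_delta hφ hε₀ hε₁ hω.1 hω.2)
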